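/- Let $M$ be a complex manifold of complex dimension $m$ and let $V_\alpha\subset M$ be an embedded complex submanifold of complex dimension $s\ge 0$ (for instance, a stratum of a Whitney stratification of a complex analytic subset of $M$), and let $x\in V_\alpha$. Fix an open neighbourhood $U_x$ of $x$ in $M$ and a $C^\infty$ diffeomorphism $(\pi,p)\colon U_x\to U_\alpha\times\mathbb D_\alpha$, where $U_\alpha=U_x\cap V_\alpha$, $\mathbb D_\alpha$ is an open Euclidean disc centred at $0$, $\pi(z)=z$ and $p(z)=0$ for $z\in U_\alpha$; let $\rho(y)=\|y\|^2$ on $\mathbb D_\alpha$. For a continuous real 1-form $\eta$ on $V_\alpha$ (a section of $T^*_{\mathbb R}V_\alpha$), its radial extension is the real 1-form $\eta'=\pi^*\eta+p^*d\rho$ on $U_x$. For a continuous complex 1-form $\omega$ on $V_\alpha$ ($\mathbb C$-linear on each tangent space), its radial extension is the complex 1-form $\omega'(v)=\eta'(v)-i\,\eta'(iv)$ on $U_x$, where $\eta'$ is the radial extension of $\eta=\mathrm{Re}\,\omega$. The Poincaré–Hopf index of a real or complex 1-form at an isolated singularity (zero) in a complex manifold of complex dimension $d>0$ is the degree of the map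 from a small sphere around the point to the unit sphere $\mathbb S^{2d-1}$ given by the normalized coefficients of the form with respect to $dx_1,dy_1,\dots,dx_d,dy_d$ (real case), respectively $dz_1,\dots,dz_d$ (complex case), in a holomorphic chart; on a $0$-dimensional manifold the index is $1$ by convention. (i) If $\eta$ is a continuous real 1-form on $V_\alpha$ with an isolated singularity at $x$, then $\eta'$ has an isolated singularity at $x$ and $$\mathrm{Ind}_{PH}(\eta,V_\alpha;x)=\mathrm{Ind}_{PH}(\eta',M;x).$$ (ii) If $\omega$ is a continuous complex 1-form on $V_\alpha$ with an isolated singularity at $x$, then $\omega'$ has an isolated singularity at $x$ and $$(-1)^s\,\mathrm{Ind}_{PH}(\omega,V_\alpha;x)=(-1)^m\,\mathrm{Ind}_{PH}(\omega',M;x).$$ -/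

import Mathlib

open Set Filter Metric MeasureTheory Topology
open scoped Manifold ContDiff

noncomputable section

/-! ### Degree of maps of spheres and local degree at an isolated zero -/

section Degree

variable {E : Type*} [NormedAddCommGroup E] [InnerProductSpace ℝ E] [FiniteDimensional ℝ E]
  [MeasurableSpace E] [BorelSpace E]

/-- The positively homogeneous extension `v ↦ ‖v‖ • g (v / ‖v‖)` to `E` of a self-map `g` of the
unit sphere of `E`.  It is smooth away from `0` iff `g` is smooth.  At a point `x` of the sphere
its derivative maps `x` to `g x` and restricts to the derivative of `g` on the tangent space
`xᗮ` of the sphere at `x`. -/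
def coneExtension (g : C(sphere (0 : E) 1, sphere (0 : E) 1)) (v : E) : E :=
  open Classical in
  if h : v = 0 then 0
  else ‖v‖ • (g ⟨‖v‖⁻¹ • v, by simp [norm_smul, h]⟩ : E)

/-- `HasDegree f d`: the continuous self-map `f` of the unit sphere of `E` has degree `d`.
For a smooth map `g` homotopic to `f`, this says `∫ g^* vol = d * ∫ vol` over the sphere.
The pull-back `g^* vol` of the volume form is `J • vol`, where `J x` is the determinant of the
tangent map of `g` at `x` in positively oriented orthonormal bases, which is the determinant
of the derivative at `x` of the homogeneous extension of `g`. -/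
def HasDegree (f : C(sphere (0 : E) 1, sphere (0 : E) 1)) (d : ℤ) : Prop :=
  ∃ g : C(sphere (0 : E) 1, sphere (0 : E) 1),
    ContDiffOn ℝ ∞ (coneExtension g) {0}ᶜ ∧ f.Homotopic g ∧
    ∫ x : sphere (0 : E) 1, (fderiv ℝ (coneExtension g) x).det ∂(volume : Measure E).toSphere =
      d * (volume : Measure E).toSphere.real univ

/-- `HasLocalDegree F a d`: on every sufficiently small sphere `S_ε` around `a`, the map `F` is
continuous and has no zero, and `F / ‖F‖ : S_ε → S` has degree `d`. -/
def HasLocalDegree (F : E → E) (a : E) (d : ℤ) : Prop :=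
  ∀ᶠ ε in 𝓝[>] (0 : ℝ), ∃ f : C(sphere (0 : E) 1, sphere (0 : E) 1),
    (∀ v : sphere (0 : E) 1, F (a + ε • (v : E)) ≠ 0 ∧
      (f v : E) = ‖F (a + ε • (v : E))‖⁻¹ • F (a + ε • (v : E))) ∧
    HasDegree f d

/-- The degree of `F / ‖F‖` on small spheres around an isolated zero `a` of a continuous `F`. -/
def localDegree (F : E → E) (a : E) : ℤ :=
  open Classical in
  if h : ∃ d, HasLocalDegree F a d then h.choose else 0

end Degree

/-- The model space `ℂ^n`. -/
abbrev Cn (n : ℕ) : Type := EuclideanSpace ℂ (Fin n)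

/-- The underlying real manifold of a complex manifold is smooth. -/
instance realManifold (n : ℕ) (M : Type*) [TopologicalSpace M] [ChartedSpace (Cn n) M]
    [IsManifold 𝓘(ℂ, Cn n) ω M] : IsManifold 𝓘(ℝ, Cn n) ∞ M := by
  refine isManifold_of_contDiffOn _ _ _ fun e e' he he' => ?_
  have h := (contDiffGroupoid ω 𝓘(ℂ, Cn n)).compatible he he'
  exact (contDiffGroupoid_le le_top h).1.restrict_scalars ℝ

/-! ### Real and complex 1-forms -/

section Forms

variable {n : ℕ} {M : Type*} [TopologicalSpace M] [ChartedSpace (Cn n) M]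

/-- The underlying real tangent space of a complex manifold. -/
abbrev RealTangent (n : ℕ) {M : Type*} [TopologicalSpace M] [ChartedSpace (Cn n) M]
    (x : M) : Type := TangentSpace 𝓘(ℝ, Cn n) x

/-- The complex tangent space of a complex manifold. -/
abbrev ComplexTangent (n : ℕ) {M : Type*} [TopologicalSpace M] [ChartedSpace (Cn n) M]
    (x : M) : Type := TangentSpace 𝓘(ℂ, Cn n) x

/-- A (not necessarily continuous) real 1-form. -/
abbrev RealForm (n : ℕ) (M : Type*) [TopologicalSpace M] [ChartedSpace (Cn n) M] : Type _ :=
  ∀ x : M, RealTangent n x →L[ℝ] ℝ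

/-- A (not necessarily continuous) complex 1-form, `ℂ`-linear on each tangent space. -/
abbrev ComplexForm (n : ℕ) (M : Type*) [TopologicalSpace M] [ChartedSpace (Cn n) M] : Type _ :=
  ∀ x : M, ComplexTangent n x →L[ℂ] ℂ

/-- `η` is a continuous section of the real cotangent bundle. -/
def RealForm.IsContinuous [IsManifold 𝓘(ℂ, Cn n) ω M] (η : RealForm n M) : Prop :=
  Continuous fun x : M => Bundle.TotalSpace.mk' (Cn n →L[ℝ] ℝ)
    (E := fun x : M => RealTangent n x →L[ℝ] ℝ) x (η x)

/-- `θ` is a continuous section of the complex cotangent bundle. -/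
def ComplexForm.IsContinuous [IsManifold 𝓘(ℂ, Cn n) ω M] (θ : ComplexForm n M) : Prop :=
  Continuous fun x : M => Bundle.TotalSpace.mk' (Cn n →L[ℂ] ℂ)
    (E := fun x : M => ComplexTangent n x →L[ℂ] ℂ) x (θ x)

/-- `x` is an isolated singularity (zero) of the real 1-form `η`. -/
def RealForm.IsIsolatedSingularity (η : RealForm n M) (x : M) : Prop :=
  η x = 0 ∧ ∀ᶠ z in 𝓝[≠] x, η z ≠ 0

/-- `x` is an isolated singularity (zero) of the complex 1-form `θ`. -/
def ComplexForm.IsIsolatedSingularity (θ : ComplexForm n M) (x : M) : Prop :=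
  θ x = 0 ∧ ∀ᶠ z in 𝓝[≠] x, θ z ≠ 0

/-- The real part of a complex 1-form. -/
def ComplexForm.re (θ : ComplexForm n M) : RealForm n M := fun x =>
  Complex.reCLM.comp ((θ x).restrictScalars ℝ)

/-- The complex 1-form `v ↦ η v - i η (i v)`, whose real part is `η`. -/
def RealForm.complexify (η : RealForm n M) : ComplexForm n M := fun x =>
  StrongDual.extendRCLike (𝕜 := ℂ) (F := Cn n) (η x)

/-- The coefficients `(a_j)` of `η = ∑ a_j dx_j` in the preferred chart at `x`, where the `x_j` are
the real coordinates of `ℂ^n = ℝ^{2n}`.  This is the vector dual to `η` for the standard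
real inner product. -/
def RealForm.coeff (η : RealForm n M) (x : M) (u : Cn n) : Cn n :=
  (InnerProductSpace.toDual ℝ (Cn n)).symm
    ((η ((chartAt (Cn n) x).symm u)).comp
      (mfderiv 𝓘(ℝ, Cn n) 𝓘(ℝ, Cn n) (chartAt (Cn n) x).symm u))

/-- The coefficients `(a_j)` of `θ = ∑ a_j dz_j` in the preferred holomorphic chart at `x`. -/
def ComplexForm.coeff (θ : ComplexForm n M) (x : M) (u : Cn n) : Cn n :=
  WithLp.toLp 2 fun j => θ ((chartAt (Cn n) x).symm u)
    (mfderiv 𝓘(ℂ, Cn n) 𝓘(ℂ, Cn n) (chartAt (Cn n) x).symm u (EuclideanSpace.single j 1))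

/-- The Poincaré–Hopf index at `x` of a real 1-form on a complex manifold of complex dimension
`n`: the degree of `η / ‖η‖` from a small sphere around `x` to the unit sphere of `ℝ^{2n}`.
By convention the index on a zero-dimensional manifold is `1`. -/
def RealForm.index (η : RealForm n M) (x : M) : ℤ :=
  if n = 0 then 1 else localDegree (η.coeff x) (chartAt (Cn n) x x)

/-- The Poincaré–Hopf index at `x` of a complex 1-form on a complex manifold of complex dimension
`n`: the degree of `θ / ‖θ‖` from a small sphere around `x` to the unit sphere of `ℂ^n`.
By convention the index on a zero-dimensional manifold is `1`. -/
def ComplexForm.index (θ : ComplexForm n M) (x : M) : ℤ :=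
  if n = 0 then 1 else localDegree (θ.coeff x) (chartAt (Cn n) x x)

end Forms

/-! ### Radial extension -/

section Radial

variable {m s : ℕ} {M : Type*} [TopologicalSpace M] [ChartedSpace (Cn m) M]
  {S : Type*} [TopologicalSpace S] [ChartedSpace (Cn s) S]

/-- A product neighbourhood `U ≅ U_α × D` of the point `ι x` of the submanifold `ι : S → M`.
Here `U` is an open subset of `M` with `U ∩ ι(S) = ι(U_α)`, `D` is an open Euclidean disc
of dimension `k`, transversal to the submanifold, and the diffeomorphism maps `ι z` to `(z, 0)`
for `z ∈ U_α`. -/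
structure ProductNhd (ι : S → M) (x : S) (k : ℕ) where
  /-- the diffeomorphism from `U` to `U_α × D` -/
  diffeo : PartialDiffeomorph 𝓘(ℝ, Cn m) (𝓘(ℝ, Cn s).prod 𝓘(ℝ, EuclideanSpace ℝ (Fin k)))
    M (S × EuclideanSpace ℝ (Fin k)) ∞
  /-- the neighbourhood `U_α` of `x` in the submanifold -/
  base : Set S
  mem_base : x ∈ base
  /-- the radius of `D` -/
  radius : ℝ
  radius_pos : 0 < radius
  target_eq : diffeo.target = base ×ˢ ball (0 : EuclideanSpace ℝ (Fin k)) radius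
  source_inter : diffeo.source ∩ range ι = ι '' base
  map_base : ∀ z ∈ base, diffeo (ι z) = (z, 0)

namespace ProductNhd

variable {ι : S → M} {x : S} {k : ℕ} (N : ProductNhd (m := m) (s := s) ι x k)

/-- The projection `π : U → U_α`. -/
def toBase (q : M) : S := (N.diffeo q).1

/-- The projection `p : U → D`. -/
def toDisc (q : M) : EuclideanSpace ℝ (Fin k) := (N.diffeo q).2

/-- The parallel extension `π^* η`, that is `v ↦ η_{π(q)} (dπ_q v)`. -/
def parallelExtension (η : RealForm s S) : RealForm m M := fun q =>
  (η (N.toBase q)).comp (mfderiv 𝓘(ℝ, Cn m) 𝓘(ℝ, Cn s) N.toBase q)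

/-- The form `p^* dρ`, where `ρ y = ‖y‖ ^ 2` on the disc. -/
def discForm : RealForm m M := fun q =>
  (mfderiv 𝓘(ℝ, EuclideanSpace ℝ (Fin k)) 𝓘(ℝ, ℝ)
      (fun y : EuclideanSpace ℝ (Fin k) => ‖y‖ ^ 2) (N.toDisc q)).comp
    (mfderiv 𝓘(ℝ, Cn m) 𝓘(ℝ, EuclideanSpace ℝ (Fin k)) N.toDisc q)

/-- The radial extension `π^* η + p^* dρ` of a real 1-form `η` on the submanifold; only its values
on `U = N.diffeo.source` are meaningful. -/
def radialExtension (η : RealForm s S) : RealForm m M := fun q =>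
  N.parallelExtension η q + N.discForm q

/-- The radial extension of a complex 1-form `θ` on the submanifold: the complex 1-form whose real
part is the radial extension of the real part of `θ`. -/
def complexRadialExtension (θ : ComplexForm s S) : ComplexForm m M :=
  (N.radialExtension θ.re).complexify

end ProductNhd

end Radial

end

/-! Near `ι x` the diffeomorphism `(π, p)`, read in the preferred charts, is a local diffeomorphism
`Ψ` from `ℂ^m` to `ℂ^s × ℝ^k`. If `G` denotes the coefficient vector of `η`, the coefficient vector
of `η'` at `u` is the transpose of `DΨ(u)` applied to `(G(Ψ₁ u), 2 Ψ₂ u)`, because `d‖y‖² = 2y·dy`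
(`eventually_coeff_eq`). Interpolating affinely between `Ψ` and its linear part `L` deforms this
vector field, without zeros on a small punctured ball, into `Lᵀ ∘ (G × 2 id) ∘ L`. The suspension by
`2 id` keeps the degree of `G`, and the linear maps contribute the sign of `det (Lᵀ L) > 0`. A
1-form is covariant, so the orientation of `Ψ` enters twice and cancels. This is (i); its core is
`exists_hasProperDegree_pullback`.

For (ii), if `θ = ∑ a_j dz_j`, then the vector representing `Re θ` in the real inner product is the
conjugate of `a`. Conjugation on `ℂ^n` has determinant `(-1)^n`, so the complex index is `(-1)^n`
times the index of the real part (`ComplexForm.index_eq`). Applied on both manifolds, this reduces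
(ii) to (i), since the real part of the complex radial extension is the radial extension of the real
part.

The degree theory is developed from the integral formula. A map of spheres is replaced by its
positively homogeneous extension, a proper self-map of a vector space, whose degree `d` satisfies `∫
φ(G) det DG = d ∫ φ` for smooth `G` at bounded distance. Homotopy invariance is Stokes' theorem for
a top-degree form. Integrality comes from Sard's theorem and the count of signs over a regular
value, and polar coordinates give back the integral over the sphere
(`hasDegree_iff_hasProperDegree`). In this form products and linear changes of variable are easy to
handle. -/

noncomputable section

/-! ### The integral formula for the degree: homotopy invariance -/

section Homotopy

variable {E : Type*} [NormedAddCommGroup E] [NormedSpace ℝ E] [FiniteDimensional ℝ E]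

/-- The determinant in a basis as a continuous alternating map. -/
def Module.Basis.detCLM {n : ℕ} (b : Module.Basis (Fin n) ℝ E) : E [⋀^Fin n]→L[ℝ] ℝ where
  toMultilinearMap := b.det.toMultilinearMap
  map_eq_zero_of_eq' := b.det.map_eq_zero_of_eq'
  cont := by
    change Continuous fun v => b.det v
    simp only [Module.Basis.det_apply]
    refine Continuous.matrix_det ?_
    refine continuous_matrix fun i j => ?_
    simp only [Module.Basis.toMatrix_apply]
    have : Continuous (b.coord i) := LinearMap.continuous_of_finiteDimensional _
    exact this.comp (continuous_apply j)

theorem Module.Basis.detCLM_apply {n : ℕ} (b : Module.Basis (Fin n) ℝ E) (v : Fin n → E) :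
    b.detCLM v = b.det v := rfl

theorem contDiff_mul_det {n : ℕ} {F : Type*} [NormedAddCommGroup F] [NormedSpace ℝ F]
    (b : Module.Basis (Fin n) ℝ E) {Φ : F → E} (hΦ : ContDiff ℝ 2 Φ) {φ : E → ℝ}
    (hφ : ContDiff ℝ 1 φ) (u : Fin n → F) :
    ContDiff ℝ 1 fun q => φ (Φ q) * b.det fun j => fderiv ℝ Φ q (u j) := by
  refine (hφ.comp (hΦ.of_le (by norm_num))).mul ?_
  refine (b.detCLM.toContinuousMultilinearMap.contDiff (n := 1)).comp (contDiff_pi.2 fun j => ?_)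
  exact (hΦ.fderiv_right (by norm_num)).clm_apply contDiff_const

/-- The form `β = φ · det` on `E` is closed for reasons of degree, hence so is `Φ^* β` on `ℝ × E`.
Evaluating `d(Φ^* β) = 0` on `(∂_t, b_1, …, b_n)` writes the time derivative of the pulled-back
density as a divergence in the space variables. -/
theorem fderiv_mul_det_eq_sum {n : ℕ} (b : Module.Basis (Fin n) ℝ E) {Φ : ℝ × E → E}
    (hΦ : ContDiff ℝ 2 Φ) {φ : E → ℝ} (hφ : ContDiff ℝ 1 φ) (p : ℝ × E) :
    fderiv ℝ (fun q => φ (Φ q) * b.det fun j => fderiv ℝ Φ q (0, b j)) p (1, 0) =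
      ∑ i : Fin n, (-1) ^ (i : ℕ) *
        fderiv ℝ (fun q => φ (Φ q) * b.det fun j => fderiv ℝ Φ q
          (i.succ.removeNth (Fin.cons (1, 0) fun j => ((0 : ℝ), b j) : Fin (n + 1) → ℝ × E) j))
          p (0, b i) := by
  set u : Fin (n + 1) → ℝ × E := Fin.cons (1, 0) fun j => ((0 : ℝ), b j) with hu
  let β : E → E [⋀^Fin n]→L[ℝ] ℝ := fun y => φ y • b.detCLM
  have hβ : Differentiable ℝ β := (hφ.differentiable (by norm_num)).smul_const _
  have hdΦ : Differentiable ℝ (fderiv ℝ Φ) :=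
    (hΦ.fderiv_right (m := 1) (by norm_num)).differentiable (by norm_num)
  have h := extDeriv_pullback (x := p) (hβ (Φ p)) hΦ.contDiffAt (by simp)
  -- An alternating form of degree `n + 1` vanishes on an `n`-dimensional space.
  have h0 : extDeriv β (Φ p) = 0 := by
    ext v
    have hv : ¬ LinearIndependent ℝ v := fun hv => by
      have := hv.fintype_card_le_finrank
      rw [Module.finrank_eq_card_basis b] at this
      simp at this
    simpa using (extDeriv β (Φ p)).toAlternatingMap.map_linearDependent v hv
  have h1 := congrArg (fun a => a u) h
  rw [extDeriv_apply, h0] at h1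
  · have key : ∀ i : Fin (n + 1), (fun q => ((β (Φ q)).compContinuousLinearMap (fderiv ℝ Φ q))
        (i.removeNth u)) = fun q => φ (Φ q) * b.det fun j => fderiv ℝ Φ q (i.removeNth u j) := by
      intro i
      ext q
      simp [β, Module.Basis.detCLM_apply, Function.comp_def]
    simp only [key] at h1
    rw [Fin.sum_univ_succ] at h1
    simp only [Fin.val_zero, pow_zero, one_smul, Fin.val_succ, pow_succ] at h1
    have e0 : u 0 = (1, 0) := by simp [hu]
    have e1 : ∀ i : Fin n, u i.succ = (0, b i) := by simp [hu]
    have e2 : ∀ j : Fin n, (Fin.removeNth 0 u) j = (0, b j) := by simp [hu, Fin.removeNth]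
    simp only [e0, e1, e2] at h1
    simp only [mul_neg, mul_one, neg_smul, zsmul_eq_mul, Int.cast_pow, Int.cast_neg, Int.cast_one,
      Finset.sum_neg_distrib] at h1
    have h2 : (ContinuousAlternatingMap.compContinuousLinearMap
      (0 : E [⋀^Fin (n+1)]→L[ℝ] ℝ) (fderiv ℝ Φ p)) u = 0 := by simp
    rw [h2] at h1
    linarith
  · exact DifferentiableAt.continuousAlternatingMapCompContinuousLinearMap
      ((hβ (Φ p)).comp p (hΦ.differentiable (by norm_num) p)) (hdΦ p)

variable [MeasurableSpace E] [BorelSpace E] (μ : Measure E) [μ.IsAddHaarMeasure]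

theorem integral_fderiv_apply_eq_zero {f : E → ℝ} (hf : ContDiff ℝ 1 f)
    (hc : HasCompactSupport f) (v : E) : ∫ x, fderiv ℝ f x v ∂μ = 0 := by
  have h := integral_mul_fderiv_eq_neg_fderiv_mul_of_integrable (μ := μ) (f := fun _ : E => (1 : ℝ))
    (g := f) (v := v) (by simp) ?_ ?_ (by fun_prop)
    (fun x _ => hf.differentiable (by norm_num) x)
  · simpa using h
  · simp only [one_mul]
    refine Continuous.integrable_of_hasCompactSupport ?_ (hc.fderiv_apply (𝕜 := ℝ) v)
    exact (hf.continuous_fderiv (by norm_num)).clm_apply continuous_const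
  · simpa using hf.continuous.integrable_of_hasCompactSupport hc

/-- The time derivative of the density is a sum of space derivatives of functions supported in `K`,
and each of these has integral zero. Integrating over `[0, 1]` and exchanging the integrals gives
the equality. -/
theorem integral_mul_det_fderiv_eq_of_homotopy {Φ : ℝ × E → E} (hΦ : ContDiff ℝ 2 Φ) {φ : E → ℝ}
    (hφ : ContDiff ℝ 1 φ) {K : Set E} (hK : IsCompact K)
    (hΦK : ∀ t ∈ Icc (0 : ℝ) 1, ∀ v ∉ K, φ (Φ (t, v)) = 0) :
    ∫ v, φ (Φ (0, v)) * (fderiv ℝ (fun v => Φ (0, v)) v).det ∂μ =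
      ∫ v, φ (Φ (1, v)) * (fderiv ℝ (fun v => Φ (1, v)) v).det ∂μ := by
  obtain ⟨n, b⟩ : ∃ n, Nonempty (Module.Basis (Fin n) ℝ E) := ⟨_, ⟨Module.finBasis ℝ E⟩⟩
  obtain ⟨b⟩ := b
  have hsl : ∀ t v, HasFDerivAt (fun v => ((t : ℝ), (v : E))) (ContinuousLinearMap.inr ℝ ℝ E) v :=
    fun t v => hasFDerivAt_prodMk_right t v
  have hst : ∀ (t : ℝ) (v : E), HasDerivAt (fun t => ((t : ℝ), v)) ((1 : ℝ), (0 : E)) t :=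
    fun t v => (hasDerivAt_id t).prodMk (hasDerivAt_const t v)
  have hdet : ∀ t v, (fderiv ℝ (fun v => Φ (t, v)) v).det =
      b.det fun j => fderiv ℝ Φ (t, v) (0, b j) := by
    intro t v
    have h1 : HasFDerivAt (fun v => Φ (t, v)) _ v :=
      (hΦ.differentiable (by norm_num) (t, v)).hasFDerivAt.comp v (hsl t v)
    rw [h1.fderiv]
    have := b.det_comp ((fderiv ℝ Φ (t, v)).comp (ContinuousLinearMap.inr ℝ ℝ E) : E →ₗ[ℝ] E) b
    rw [b.det_self, mul_one] at this
    rw [ContinuousLinearMap.det, ← this]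
    congr 1
  simp only [hdet]
  set h : ℝ × E → ℝ := fun q => φ (Φ q) * b.det fun j => fderiv ℝ Φ q (0, b j) with hh
  have hC : ContDiff ℝ 1 h := contDiff_mul_det b hΦ hφ _
  have hcd : Continuous fun q => fderiv ℝ h q (1, 0) :=
    (hC.continuous_fderiv (by norm_num)).clm_apply continuous_const
  change ∫ v, h (0, v) ∂μ = ∫ v, h (1, v) ∂μ
  have hzero : ∀ t ∈ Icc (0 : ℝ) 1, ∀ v ∉ K, h (t, v) = 0 := fun t ht v hv => by
    simp [hh, hΦK t ht v hv]
  have hint : ∀ t ∈ Icc (0 : ℝ) 1, Integrable (fun v => h (t, v)) μ := fun t ht =>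
    (hC.continuous.comp (by fun_prop)).integrable_of_hasCompactSupport
      (HasCompactSupport.intro hK (hzero t ht))
  have hft : ∀ v, h (1, v) - h (0, v) = ∫ t in (0 : ℝ)..1, fderiv ℝ h (t, v) (1, 0) := by
    intro v
    rw [intervalIntegral.integral_eq_sub_of_hasDerivAt (f := fun t => h (t, v))]
    · intro t _
      exact (hC.differentiable (by norm_num) (t, v)).hasFDerivAt.comp_hasDerivAt t (hst t v)
    · exact (hcd.comp (by fun_prop)).intervalIntegrable _ _
  have hzd : ∀ t ∈ Ioo (0 : ℝ) 1, ∀ v ∉ K, fderiv ℝ h (t, v) = 0 := by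
    intro t ht v hv
    have : h =ᶠ[𝓝 (t, v)] fun _ => 0 := by
      filter_upwards [(isOpen_Ioo.prod hK.isClosed.isOpen_compl).mem_nhds
        (show (t, v) ∈ Ioo (0 : ℝ) 1 ×ˢ Kᶜ from ⟨ht, hv⟩)] with q hq
      exact hzero q.1 (Ioo_subset_Icc_self hq.1) q.2 hq.2
    rw [this.fderiv_eq]; simp
  have hsw : ∫ v, (∫ t in (0 : ℝ)..1, fderiv ℝ h (t, v) (1, 0)) ∂μ =
      ∫ t in (0 : ℝ)..1, (∫ v, fderiv ℝ h (t, v) (1, 0) ∂μ) := by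
    -- The open interval is needed: vanishing off `K` is known only for times in `[0, 1]`, so the
    -- full derivative on `ℝ × E` is known to vanish only at interior times.
    simp only [intervalIntegral.integral_of_le zero_le_one, integral_Ioc_eq_integral_Ioo]
    refine integral_integral_swap ?_
    have hi : IntegrableOn (fun q : E × ℝ => fderiv ℝ h (q.2, q.1) (1, 0)) (K ×ˢ Icc (0 : ℝ) 1)
        (μ.prod volume) :=
      (hcd.comp (by fun_prop : Continuous fun q : E × ℝ => (q.2, q.1))).continuousOn.integrableOn_compact
        (hK.prod isCompact_Icc)
    have hi2 : IntegrableOn (fun q : E × ℝ => fderiv ℝ h (q.2, q.1) (1, 0))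
        (univ ×ˢ Ioo (0 : ℝ) 1) (μ.prod volume) := by
      refine (hi.mono_set (prod_mono_right Ioo_subset_Icc_self)).of_forall_sdiff_eq_zero
        (MeasurableSet.univ.prod measurableSet_Ioo) ?_
      rintro ⟨v, t⟩ ⟨⟨-, ht⟩, h2⟩
      have hv : v ∉ K := fun hv => h2 ⟨hv, ht⟩
      simp [hzd t ht v hv]
    rwa [IntegrableOn, ← Measure.prod_restrict, Measure.restrict_univ] at hi2
  have hin : ∀ t ∈ Icc (0 : ℝ) 1, ∫ v, fderiv ℝ h (t, v) (1, 0) ∂μ = 0 := by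
    intro t ht
    simp only [hh, fderiv_mul_det_eq_sum b hΦ hφ]
    set u : Fin (n + 1) → ℝ × E := Fin.cons (1, 0) fun j => ((0 : ℝ), b j)
    have hCi : ∀ i : Fin n, ContDiff ℝ 1 fun q => φ (Φ q) * b.det fun j => fderiv ℝ Φ q
        (i.succ.removeNth u j) := fun i => contDiff_mul_det b hΦ hφ _
    have hsi : ∀ i : Fin n, ∀ v, fderiv ℝ (fun q => φ (Φ q) * b.det fun j => fderiv ℝ Φ q
        (i.succ.removeNth u j)) (t, v) (0, b i) = fderiv ℝ (fun v => φ (Φ (t, v)) * b.det fun j =>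
        fderiv ℝ Φ (t, v) (i.succ.removeNth u j)) v (b i) := by
      intro i v
      have h1 : HasFDerivAt (fun v => φ (Φ (t, v)) * b.det fun j =>
        fderiv ℝ Φ (t, v) (i.succ.removeNth u j)) _ v :=
        ((hCi i).differentiable (by norm_num) (t, v)).hasFDerivAt.comp v (hsl t v)
      rw [h1.fderiv]
      simp
    simp only [hsi]
    have hCt : ∀ i : Fin n, ContDiff ℝ 1 (fun v => φ (Φ (t, v)) * b.det fun j =>
        fderiv ℝ Φ (t, v) (i.succ.removeNth u j)) := fun i => (hCi i).comp (by fun_prop)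
    have hcs : ∀ i : Fin n, HasCompactSupport (fun v => φ (Φ (t, v)) * b.det fun j =>
        fderiv ℝ Φ (t, v) (i.succ.removeNth u j)) := fun i =>
      HasCompactSupport.intro hK fun v hv => by simp [hΦK t ht v hv]
    rw [integral_finsetSum]
    · refine Finset.sum_eq_zero fun i _ => ?_
      rw [integral_const_mul, integral_fderiv_apply_eq_zero μ (hCt i) (hcs i), mul_zero]
    · intro i _
      refine Integrable.const_mul ?_ _
      exact (((hCt i).continuous_fderiv (by norm_num)).clm_apply
        continuous_const).integrable_of_hasCompactSupport ((hcs i).fderiv_apply (𝕜 := ℝ) _)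
  have hfin : ∫ v, (h (1, v) - h (0, v)) ∂μ = 0 := by
    simp only [hft]
    rw [hsw, intervalIntegral.integral_congr (g := fun _ => (0 : ℝ))]
    · simp
    · intro t ht
      rw [uIcc_of_le zero_le_one] at ht
      exact hin t ht
  rw [integral_sub (hint 1 (by simp)) (hint 0 (by simp))] at hfin
  linarith

end Homotopy
end

noncomputable section

/-! ### The degree of proper maps of a vector space -/

section ProperDegree

variable {E : Type*} [NormedAddCommGroup E] [NormedSpace ℝ E]

/-- The affine homotopy from `F₀` to `F₁` is proper. -/
def AffineProper (F₀ F₁ : E → E) : Prop :=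
  ∀ R : ℝ, ∃ K : Set E, IsCompact K ∧
    ∀ t ∈ Icc (0 : ℝ) 1, ∀ v ∉ K, R < ‖F₀ v + t • (F₁ v - F₀ v)‖

/-- At each time the two homotopies differ by a convex combination of the two errors, so a margin of
`C₀ + C₁` in the radius suffices. -/
theorem AffineProper.of_bounded {F₀ F₁ G₀ G₁ : E → E} (h : AffineProper F₀ F₁) {C₀ C₁ : ℝ}
    (h₀ : ∀ v, ‖G₀ v - F₀ v‖ ≤ C₀) (h₁ : ∀ v, ‖G₁ v - F₁ v‖ ≤ C₁) : AffineProper G₀ G₁ := by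
  intro R
  obtain ⟨K, hK, hR⟩ := h (R + C₀ + C₁)
  refine ⟨K, hK, fun t ht v hv => ?_⟩
  have h1 := hR t ht v hv
  have e : F₀ v + t • (F₁ v - F₀ v) = (G₀ v + t • (G₁ v - G₀ v)) -
      ((1 - t) • (G₀ v - F₀ v) + t • (G₁ v - F₁ v)) := by module
  have h2 : ‖(1 - t) • (G₀ v - F₀ v) + t • (G₁ v - F₁ v)‖ ≤ C₀ + C₁ := by
    refine (norm_add_le _ _).trans ?_
    rw [norm_smul, norm_smul, Real.norm_of_nonneg ht.1, Real.norm_of_nonneg (by linarith [ht.2])]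
    refine add_le_add ?_ ?_
    · exact (mul_le_of_le_one_left (norm_nonneg _) (by linarith [ht.1])).trans (h₀ v)
    · exact (mul_le_of_le_one_left (norm_nonneg _) ht.2).trans (h₁ v)
  rw [e] at h1
  linarith [norm_sub_le (G₀ v + t • (G₁ v - G₀ v))
    ((1 - t) • (G₀ v - F₀ v) + t • (G₁ v - F₁ v))]

variable [FiniteDimensional ℝ E]

theorem AffineProper.isProperMap {F : E → E} (h : AffineProper F F) (hF : Continuous F) :
    IsProperMap F := by
  rw [isProperMap_iff_tendsto_cocompact]
  refine ⟨hF, ?_⟩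
  rw [← cobounded_eq_cocompact, ← tendsto_norm_atTop_iff_cobounded, cobounded_eq_cocompact,
    Filter.tendsto_atTop]
  intro R
  obtain ⟨K, hK, hR⟩ := h R
  filter_upwards [hK.compl_mem_cocompact] with v hv
  simpa using (hR 0 (by simp) v hv).le

theorem exists_contDiff_approx_one {F : E → E} (hF : Continuous F) :
    ∃ G : E → E, ContDiff ℝ ∞ G ∧ ∀ v, ‖G v - F v‖ ≤ 1 := by
  obtain ⟨G, hG, hFG, -⟩ := hF.exists_contDiff_approx (ε := fun _ => 1) ⊤ continuous_const (by simp)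
  exact ⟨G, hG, fun v => by simpa [dist_eq_norm] using (hFG v).le⟩

variable [MeasurableSpace E] [BorelSpace E] (μ : Measure E) [μ.IsAddHaarMeasure]

theorem integral_mul_det_fderiv_eq_of_affineProper {G₀ G₁ : E → E} (h₀ : ContDiff ℝ ∞ G₀)
    (h₁ : ContDiff ℝ ∞ G₁) (h : AffineProper G₀ G₁) {φ : E → ℝ} (hφ : ContDiff ℝ ∞ φ)
    (hc : HasCompactSupport φ) :
    ∫ v, φ (G₀ v) * (fderiv ℝ G₀ v).det ∂μ = ∫ v, φ (G₁ v) * (fderiv ℝ G₁ v).det ∂μ := by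
  obtain ⟨R, hR⟩ := hc.isBounded.subset_closedBall 0
  obtain ⟨K, hK, hKR⟩ := h R
  have := integral_mul_det_fderiv_eq_of_homotopy μ
    (Φ := fun p : ℝ × E => G₀ p.2 + p.1 • (G₁ p.2 - G₀ p.2)) (φ := φ) (K := K) ?_
    (hφ.of_le (by norm_cast)) hK ?_
  · simpa using this
  · have h0 : ContDiff ℝ 2 G₀ := h₀.of_le (by norm_cast)
    have h1 : ContDiff ℝ 2 G₁ := h₁.of_le (by norm_cast)
    fun_prop
  · intro t ht v hv
    refine image_eq_zero_of_notMem_tsupport fun hmem => ?_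
    have := hR hmem
    rw [mem_closedBall_zero_iff] at this
    linarith [hKR t ht v hv]

/-- `HasProperDegree μ F d`: the continuous proper map `F` of a finite-dimensional vector space
has degree `d`, in terms of the integral formula for a smooth map at bounded distance of `F`. -/
def HasProperDegree (F : E → E) (d : ℤ) : Prop :=
  ∃ G : E → E, ContDiff ℝ ∞ G ∧ (∃ C, ∀ v, ‖G v - F v‖ ≤ C) ∧
    ∀ φ : E → ℝ, ContDiff ℝ ∞ φ → HasCompactSupport φ →
      ∫ v, φ (G v) * (fderiv ℝ G v).det ∂μ = d * ∫ v, φ v ∂μ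

theorem HasProperDegree.integral_eq {F : E → E} {d : ℤ} (hd : HasProperDegree μ F d) {G : E → E}
    (hG : ContDiff ℝ ∞ G) (hFG : AffineProper F G) {φ : E → ℝ} (hφ : ContDiff ℝ ∞ φ)
    (hc : HasCompactSupport φ) :
    ∫ v, φ (G v) * (fderiv ℝ G v).det ∂μ = d * ∫ v, φ v ∂μ := by
  obtain ⟨G', hG', ⟨C, hC⟩, h⟩ := hd
  rw [← h φ hφ hc]
  exact (integral_mul_det_fderiv_eq_of_affineProper μ hG' hG
    (hFG.of_bounded (C₁ := 0) hC (by simp)) hφ hc).symm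

theorem HasProperDegree.of_affineProper {F₀ F₁ : E → E} {d : ℤ} (hd : HasProperDegree μ F₀ d)
    (h : AffineProper F₀ F₁) (hF₁ : Continuous F₁) : HasProperDegree μ F₁ d := by
  obtain ⟨G, hG, hFG⟩ := exists_contDiff_approx_one hF₁
  exact ⟨G, hG, ⟨1, hFG⟩, fun φ hφ hc =>
    hd.integral_eq μ hG (h.of_bounded (C₀ := 0) (by simp) hFG) hφ hc⟩

/-- Two smooth maps at bounded distance from `F` are joined by a proper affine homotopy, so their
integrals agree; a bump function with positive integral then separates the degrees. -/
theorem HasProperDegree.unique {F : E → E} {d d' : ℤ} (hd : HasProperDegree μ F d)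
    (hd' : HasProperDegree μ F d') (hF : AffineProper F F) : d = d' := by
  obtain ⟨G, hG, ⟨C, hC⟩, h⟩ := hd
  let f : ContDiffBump (0 : E) := ⟨1, 2, by norm_num, by norm_num⟩
  have h1 := h f f.contDiff f.hasCompactSupport
  rw [hd'.integral_eq μ hG (hF.of_bounded (C₀ := 0) (by simp) hC) f.contDiff
    f.hasCompactSupport] at h1
  exact_mod_cast (mul_right_cancel₀ (f.integral_pos (μ := μ)).ne' h1).symm

/-- Sard's theorem in equal dimensions: the image of the critical set has measure zero, so it is not
the whole space. -/
theorem exists_forall_det_fderiv_ne_zero {G : E → E} (hG : Differentiable ℝ G) :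
    ∃ y, ∀ v, G v = y → (fderiv ℝ G v).det ≠ 0 := by
  by_contra! hcon
  have h := addHaar_image_eq_zero_of_det_fderivWithin_eq_zero (MeasureTheory.Measure.addHaar (G := E))
    (f := G) (s := {v | (fderiv ℝ G v).det = 0}) (f' := fderiv ℝ G)
    (fun v _ => (hG v).hasFDerivAt.hasFDerivWithinAt) (fun v hv => hv)
  have h2 : G '' {v | (fderiv ℝ G v).det = 0} = univ := by
    refine eq_univ_of_forall fun y => ?_
    obtain ⟨v, hv, hv'⟩ := hcon y
    exact ⟨v, hv', hv⟩
  rw [h2] at h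
  exact (NeZero.ne _) h

/-- Over a small ball around a regular value, the relevant part of a proper map consists of finitely
many disjoint sheets on which it is injective. Change of variables on a sheet contributes `± ∫ φ`,
with the sign of the Jacobian there. -/
theorem exists_integral_eq_near_regularValue {G : E → E} (hG : ContDiff ℝ ∞ G)
    (hp : IsProperMap G) {y : E} (hy : ∀ v, G v = y → (fderiv ℝ G v).det ≠ 0) :
    ∃ δ > 0, ∃ d : ℤ, ∀ φ : E → ℝ, (∀ v ∉ ball y δ, φ v = 0) → Continuous φ →
      ∫ v, φ (G v) * (fderiv ℝ G v).det ∂μ = d * ∫ v, φ v ∂μ := by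
  have hdc : Continuous fun v => (fderiv ℝ G v).det :=
    ContinuousLinearMap.continuous_det.comp (hG.continuous_fderiv (by simp))
  have hW : ∀ x, G x = y → ∃ W : Set E, IsOpen W ∧ x ∈ W ∧ InjOn G W ∧
      (∀ U ⊆ W, IsOpen U → x ∈ U → G '' U ∈ 𝓝 y) ∧
      ∀ v ∈ W, (fderiv ℝ G v).det =
        (SignType.sign (fderiv ℝ G x).det : ℤ) * |(fderiv ℝ G v).det| := by
    intro x hx
    have hst : HasStrictFDerivAt G
        (((fderiv ℝ G x).toContinuousLinearEquivOfDetNeZero (hy x hx) : E ≃L[ℝ] E) : E →L[ℝ] E) x :=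
      by
        have := (hG.contDiffAt (x := x)).hasStrictFDerivAt (by simp)
        convert this using 1
        ext v; simp
    refine ⟨(hst.toOpenPartialHomeomorph G).source ∩
      {v | 0 < (SignType.sign (fderiv ℝ G x).det : ℝ) * (fderiv ℝ G v).det}, ?_, ?_, ?_, ?_, ?_⟩
    · exact (hst.toOpenPartialHomeomorph G).open_source.inter
        (isOpen_lt continuous_const (continuous_const.mul hdc))
    · refine ⟨hst.mem_toOpenPartialHomeomorph_source, ?_⟩
      rw [mem_ofPred_eq, sign_mul_self]
      exact abs_pos.2 (hy x hx)
    · exact (hst.toOpenPartialHomeomorph G).injOn.mono inter_subset_left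
    · intro U _ hU hxU
      rw [← hx, ← hst.map_nhds_eq_of_equiv]
      exact image_mem_map (hU.mem_nhds hxU)
    · rintro v ⟨-, hv⟩
      rw [mem_ofPred_eq] at hv
      rcases lt_or_gt_of_ne (hy x hx) with h | h
      · simp only [sign_neg h, SignType.coe_neg_one, neg_mul, one_mul] at hv
        simp [sign_neg h, abs_of_neg (show (fderiv ℝ G v).det < 0 by linarith)]
      · simp only [sign_pos h, SignType.coe_one, one_mul] at hv
        simp [sign_pos h, abs_of_pos hv]
  choose! W hWo hWx hWi hWn hWs using hW
  have hPc : IsCompact (G ⁻¹' {y}) := hp.isCompact_preimage isCompact_singleton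
  obtain ⟨t, htP, htc⟩ := hPc.elim_nhds_subcover W fun x hx => (hWo x hx).mem_nhds (hWx x hx)
  have hPf : (G ⁻¹' {y}).Finite := by
    refine t.finite_toSet.subset fun x hx => ?_
    obtain ⟨z, hz, hxz⟩ := mem_iUnion₂.1 (htc hx)
    rwa [hWi z (htP z hz) hxz (hWx z (htP z hz)) (hx.trans (htP z hz).symm)]
  obtain ⟨U, hU, hUd⟩ := hPf.t2_separation
  set V : E → Set E := fun x => U x ∩ W x with hV
  have hVo : ∀ x ∈ G ⁻¹' {y}, IsOpen (V x) := fun x hx => (hU x).2.inter (hWo x hx)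
  have hVx : ∀ x ∈ G ⁻¹' {y}, x ∈ V x := fun x hx => ⟨(hU x).1, hWx x hx⟩
  have hVu : IsOpen (⋃ x ∈ G ⁻¹' {y}, V x) := isOpen_biUnion hVo
  -- A proper map is closed, so points outside all sheets are not sent close to `y`.
  have hcl : (G '' (⋃ x ∈ G ⁻¹' {y}, V x)ᶜ)ᶜ ∈ 𝓝 y := by
    refine (hp.isClosedMap _ hVu.isClosed_compl).isOpen_compl.mem_nhds ?_
    rintro ⟨x, hx, hxy⟩
    exact hx (mem_iUnion₂.2 ⟨x, hxy, hVx x hxy⟩)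
  have him : (⋂ x ∈ G ⁻¹' {y}, G '' V x) ∈ 𝓝 y :=
    (biInter_mem hPf).2 fun x hx => hWn x hx _ inter_subset_right (hVo x hx) (hVx x hx)
  obtain ⟨δ, hδ, hball⟩ := Metric.mem_nhds_iff.1 (inter_mem hcl him)
  -- The integer is the signed count of preimages of the regular value.
  refine ⟨δ, hδ, ∑ x ∈ hPf.toFinset, (SignType.sign (fderiv ℝ G x).det : ℤ), fun φ hφ hφc => ?_⟩
  have hφi : HasCompactSupport φ := HasCompactSupport.intro (isCompact_closedBall y δ)
    fun v hv => hφ v fun hv' => hv (ball_subset_closedBall hv')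
  have hint : Integrable (fun v => φ (G v) * (fderiv ℝ G v).det) μ := by
    refine ((hφc.comp hG.continuous).mul hdc).integrable_of_hasCompactSupport ?_
    refine HasCompactSupport.intro (hp.isCompact_preimage hφi) fun v hv => ?_
    simp [image_eq_zero_of_notMem_tsupport hv]
  have h1 : ∫ v, φ (G v) * (fderiv ℝ G v).det ∂μ =
      ∫ v in ⋃ x ∈ hPf.toFinset, V x, φ (G v) * (fderiv ℝ G v).det ∂μ := by
    refine (setIntegral_eq_integral_of_forall_compl_eq_zero fun v hv => ?_).symm
    have hv2 : G v ∉ ball y δ := fun hv2 => (hball hv2).1 ⟨v, by simpa using hv, rfl⟩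
    simp [hφ _ hv2]
  rw [h1, integral_biUnion_finset]
  · push_cast
    rw [Finset.sum_mul]
    refine Finset.sum_congr rfl fun x hx => ?_
    have hx : x ∈ G ⁻¹' {y} := by simpa using hx
    have h2 : ∫ v in V x, φ (G v) * (fderiv ℝ G v).det ∂μ =
        ∫ v in V x, (SignType.sign (fderiv ℝ G x).det : ℤ) *
          (|(fderiv ℝ G v).det| • φ (G v)) ∂μ := by
      refine setIntegral_congr_fun (hVo x hx).measurableSet fun v hv => ?_
      simp only [smul_eq_mul]
      rw [hWs x hx v hv.2, abs_mul, abs_abs]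
      have h3 : ((SignType.sign (fderiv ℝ G x).det : ℤ) : ℝ) *
        |((SignType.sign (fderiv ℝ G x).det : ℤ) : ℝ)| =
          ((SignType.sign (fderiv ℝ G x).det : ℤ) : ℝ) := by
        rcases SignType.sign (fderiv ℝ G x).det <;> simp
      linear_combination -φ (G v) * |(fderiv ℝ G v).det| * h3
    rw [h2, integral_const_mul, ← integral_image_eq_integral_abs_det_fderiv_smul μ
      (hVo x hx).measurableSet (fun v _ => (hG.differentiable (by simp) v).hasFDerivAt.hasFDerivWithinAt)
      ((hWi x hx).mono inter_subset_right)]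
    refine congrArg₂ _ (by simp) ?_
    refine setIntegral_eq_integral_of_forall_compl_eq_zero fun v hv => hφ v fun hv2 => hv ?_
    exact mem_iInter₂.1 (hball hv2).2 x hx
  · intro x hx
    exact (hVo x (by simpa using hx)).measurableSet
  · intro x hx x' hx' hne
    exact (hUd (by simpa using hx) (by simpa using hx') hne).mono inter_subset_left inter_subset_left
  · intro x _
    exact hint.integrableOn

/-- Translating the target moves `G` by a bounded amount, so the integral is a translation-invariant
functional of `φ`. -/
theorem integral_comp_sub_mul_det_fderiv {G : E → E} (hG : ContDiff ℝ ∞ G)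
    (hp : AffineProper G G) {φ : E → ℝ} (hφ : ContDiff ℝ ∞ φ) (hc : HasCompactSupport φ) (z : E) :
    ∫ v, φ (G v - z) * (fderiv ℝ G v).det ∂μ = ∫ v, φ (G v) * (fderiv ℝ G v).det ∂μ := by
  have := integral_mul_det_fderiv_eq_of_affineProper μ hG (hG.sub contDiff_const)
    (hp.of_bounded (C₀ := 0) (C₁ := ‖z‖) (G₁ := fun v => G v - z) (by simp) (by simp)) hφ hc
  rw [this]
  simp only [fderiv_sub_const]

/-- A translation-invariant functional should be a multiple of `∫ φ`. To prove it and find the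
factor, let `I(φ)` be the left side and `ψ` a bump near a regular value. The double integral of
`ψ(z) φ(G v - z) det DG(v)` equals `(∫ ψ) I(φ)` and, after swapping the roles of `φ` and `ψ`, also
`(∫ φ) I(ψ) = d (∫ φ)(∫ ψ)`. -/
theorem exists_forall_integral_eq {G : E → E} (hG : ContDiff ℝ ∞ G) (hp : AffineProper G G) :
    ∃ d : ℤ, ∀ φ : E → ℝ, ContDiff ℝ ∞ φ → HasCompactSupport φ →
      ∫ v, φ (G v) * (fderiv ℝ G v).det ∂μ = d * ∫ v, φ v ∂μ := by
  have hpr := hp.isProperMap hG.continuous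
  obtain ⟨y, hy⟩ := exists_forall_det_fderiv_ne_zero (hG.differentiable (by simp))
  obtain ⟨δ, hδ, d, hd⟩ := exists_integral_eq_near_regularValue μ hG hpr hy
  refine ⟨d, fun φ hφ hc => ?_⟩
  have hdc : Continuous fun v => (fderiv ℝ G v).det :=
    ContinuousLinearMap.continuous_det.comp (hG.continuous_fderiv (by simp))
  let ψ : ContDiffBump y := ⟨δ / 2, δ, by positivity, by linarith⟩
  have hψ : ∀ v ∉ ball y δ, ψ v = 0 := fun v hv => by
    have := ψ.support_eq
    by_contra h
    exact hv (this ▸ h)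
  have hψpos : 0 < ∫ v, ψ v ∂μ := ψ.integral_pos
  have hGc := hG.continuous
  obtain ⟨R, hR⟩ := hc.isBounded.subset_closedBall 0
  have hi : Integrable (Function.uncurry fun z v => ψ z * (φ (G v - z) * (fderiv ℝ G v).det))
      (μ.prod μ) := by
    refine Continuous.integrable_of_hasCompactSupport ?_ ?_
    · have := ψ.continuous
      have := hφ.continuous
      have := hdc.comp (continuous_snd (X := E))
      simp only [Function.uncurry_def, Function.comp_def] at this ⊢
      fun_prop
    · refine HasCompactSupport.intro (K := closedBall y δ ×ˢ (G ⁻¹' closedBall 0 (R + (‖y‖ + δ))))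
        ((isCompact_closedBall _ _).prod (hpr.isCompact_preimage (isCompact_closedBall _ _))) ?_
      rintro ⟨z, v⟩ hzv
      simp only [Function.uncurry_apply_pair]
      by_cases hz : z ∈ closedBall y δ
      · have hv : φ (G v - z) = 0 := by
          by_contra h
          refine hzv ⟨hz, ?_⟩
          have h1 := hR (subset_tsupport _ h)
          rw [mem_closedBall_zero_iff] at h1
          rw [mem_preimage, mem_closedBall_zero_iff]
          have h2 : ‖z‖ ≤ ‖y‖ + δ := by
            have := norm_le_norm_add_norm_sub' z y
            rw [mem_closedBall, dist_eq_norm] at hz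
            linarith
          calc ‖G v‖ = ‖(G v - z) + z‖ := by simp
            _ ≤ _ := norm_add_le _ _
            _ ≤ _ := add_le_add h1 h2
        simp [hv]
      · have : ψ z = 0 := hψ z fun h => hz (ball_subset_closedBall h)
        simp [this]
  have h1 : ∫ z, ∫ v, ψ z * (φ (G v - z) * (fderiv ℝ G v).det) ∂μ ∂μ =
      (∫ z, ψ z ∂μ) * ∫ v, φ (G v) * (fderiv ℝ G v).det ∂μ := by
    simp only [integral_const_mul, integral_comp_sub_mul_det_fderiv μ hG hp hφ hc,
      integral_mul_const]
  have h2 : ∀ v, ∫ z, ψ z * (φ (G v - z) * (fderiv ℝ G v).det) ∂μ =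
      ∫ z, φ z * (ψ (G v - z) * (fderiv ℝ G v).det) ∂μ := by
    intro v
    -- The substitution `z ↦ G v - z` exchanges `φ` and `ψ`.
    rw [← integral_sub_left_eq_self (fun z => ψ z * (φ (G v - z) * (fderiv ℝ G v).det)) μ (G v)]
    refine integral_congr_ae (ae_of_all _ fun z => ?_)
    simp only [sub_sub_cancel]
    ring
  have hi' : Integrable (Function.uncurry fun z v => φ z * (ψ (G v - z) * (fderiv ℝ G v).det))
      (μ.prod μ) := by
    refine Continuous.integrable_of_hasCompactSupport ?_ ?_
    · have := ψ.continuous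
      have := hφ.continuous
      have := hdc.comp (continuous_snd (X := E))
      simp only [Function.uncurry_def, Function.comp_def] at this ⊢
      fun_prop
    · refine HasCompactSupport.intro (K := tsupport φ ×ˢ (G ⁻¹' closedBall 0 (R + (‖y‖ + δ))))
        (hc.prod (hpr.isCompact_preimage (isCompact_closedBall _ _))) ?_
      rintro ⟨z, v⟩ hzv
      simp only [Function.uncurry_apply_pair]
      by_cases hz : z ∈ tsupport φ
      · have hv : ψ (G v - z) = 0 := by
          refine hψ _ fun h => hzv ⟨hz, ?_⟩
          have h1 := hR hz
          rw [mem_closedBall_zero_iff] at h1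
          rw [mem_preimage, mem_closedBall_zero_iff]
          have h2 : ‖G v - z‖ ≤ ‖y‖ + δ := by
            have := norm_le_norm_add_norm_sub' (G v - z) y
            rw [mem_ball, dist_eq_norm] at h
            linarith
          calc ‖G v‖ = ‖z + (G v - z)‖ := by simp
            _ ≤ _ := norm_add_le _ _
            _ ≤ _ := add_le_add h1 h2
        simp [hv]
      · simp [image_eq_zero_of_notMem_tsupport hz]
  rw [integral_integral_swap hi] at h1
  simp only [h2] at h1
  rw [← integral_integral_swap hi'] at h1
  simp only [integral_const_mul, integral_comp_sub_mul_det_fderiv μ hG hp ψ.contDiff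
    ψ.hasCompactSupport, integral_mul_const, hd ψ hψ ψ.continuous] at h1
  refine mul_left_cancel₀ hψpos.ne' (h1.symm.trans ?_)
  ring

theorem exists_hasProperDegree {F : E → E} (hF : Continuous F) (hp : AffineProper F F) :
    ∃ d, HasProperDegree μ F d := by
  obtain ⟨G, hG, hFG⟩ := exists_contDiff_approx_one hF
  obtain ⟨d, hd⟩ := exists_forall_integral_eq μ hG (hp.of_bounded hFG hFG)
  exact ⟨d, G, hG, ⟨1, hFG⟩, hd⟩

end ProperDegree
end

noncomputable section

/-! ### Homogeneous extensions and operations on the degree -/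

section Homogeneous

variable {E : Type*} [NormedAddCommGroup E] [NormedSpace ℝ E]

/-- The positively homogeneous extension of the restriction of `h` to the unit sphere. -/
def homExt (h : E → E) (v : E) : E := ‖v‖ • h (‖v‖⁻¹ • v)

theorem norm_inv_smul_mem_sphere {v : E} (hv : v ≠ 0) : ‖v‖⁻¹ • v ∈ sphere (0 : E) 1 := by
  simp [norm_smul, hv]

variable [FiniteDimensional ℝ E]

theorem continuous_homExt {h : E → E} (hc : ContinuousOn h (sphere 0 1)) :
    Continuous (homExt h) := by
  obtain ⟨C, hC⟩ := (isCompact_sphere (0 : E) 1).exists_bound_of_continuousOn hc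
  refine continuous_iff_continuousAt.2 fun v => ?_
  rcases eq_or_ne v 0 with rfl | hv
  · have h0 : homExt h 0 = 0 := by simp [homExt]
    rw [ContinuousAt, h0]
    refine squeeze_zero_norm (a := fun v => |C| * ‖v‖) (fun v => ?_) ?_
    · rcases eq_or_ne v 0 with rfl | hv
      · simp [homExt]
      · rw [homExt, norm_smul, norm_norm, mul_comm]
        gcongr
        exact (hC _ (norm_inv_smul_mem_sphere hv)).trans (le_abs_self _)
    · have : Continuous fun v : E => |C| * ‖v‖ := by fun_prop
      simpa using this.tendsto 0
  · have h1 : ContinuousOn (homExt h) {0}ᶜ := by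
      refine continuous_norm.continuousOn.smul (hc.comp ?_ fun v hv => norm_inv_smul_mem_sphere hv)
      exact (continuous_norm.continuousOn.inv₀ fun v hv => norm_ne_zero_iff.2 hv).smul continuousOn_id
    exact h1.continuousAt (isOpen_compl_singleton.mem_nhds hv)

/-- By compactness the segments between `h₀` and `h₁` on the sphere stay at distance at least some
`c > 0` from the origin; by homogeneity the extended homotopy has norm at least `c ‖v‖`. -/
theorem affineProper_homExt {h₀ h₁ : E → E} (hc₀ : ContinuousOn h₀ (sphere 0 1))
    (hc₁ : ContinuousOn h₁ (sphere 0 1))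
    (hne : ∀ t ∈ Icc (0 : ℝ) 1, ∀ v ∈ sphere (0 : E) 1, h₀ v + t • (h₁ v - h₀ v) ≠ 0) :
    AffineProper (homExt h₀) (homExt h₁) := by
  have hcc : ContinuousOn (fun p : ℝ × E => ‖h₀ p.2 + p.1 • (h₁ p.2 - h₀ p.2)‖)
      (Icc (0 : ℝ) 1 ×ˢ sphere 0 1) := by
    have e0 := hc₀.comp (continuous_snd (X := ℝ)).continuousOn fun p (hp : p ∈ Icc (0 : ℝ) 1 ×ˢ _) => hp.2
    have e1 := hc₁.comp (continuous_snd (X := ℝ)).continuousOn fun p (hp : p ∈ Icc (0 : ℝ) 1 ×ˢ _) => hp.2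
    exact (e0.add (continuous_fst.continuousOn.smul (e1.sub e0))).norm
  obtain ⟨c, hc, hcle⟩ := (isCompact_Icc.prod (isCompact_sphere (0 : E) 1)).exists_forall_le' hcc
    (a := 0) fun p hp => norm_pos_iff.2 (hne p.1 hp.1 p.2 hp.2)
  refine fun R => ⟨closedBall 0 (|R| / c), isCompact_closedBall _ _, fun t ht v hv => ?_⟩
  rw [mem_closedBall_zero_iff, not_le, div_lt_iff₀ hc] at hv
  have hv0 : v ≠ 0 := by
    rintro rfl
    simp only [norm_zero, zero_mul] at hv
    exact absurd hv (not_lt.2 (abs_nonneg R))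
  have e : homExt h₀ v + t • (homExt h₁ v - homExt h₀ v) = ‖v‖ •
      (h₀ (‖v‖⁻¹ • v) + t • (h₁ (‖v‖⁻¹ • v) - h₀ (‖v‖⁻¹ • v))) := by
    simp only [homExt]; module
  rw [e, norm_smul, norm_norm]
  calc R ≤ |R| := le_abs_self R
    _ < ‖v‖ * c := hv
    _ ≤ _ := by
      gcongr
      exact hcle (t, ‖v‖⁻¹ • v) ⟨ht, norm_inv_smul_mem_sphere hv0⟩

theorem affineProper_homExt_self {h : E → E} (hc : ContinuousOn h (sphere 0 1))
    (hne : ∀ v ∈ sphere (0 : E) 1, h v ≠ 0) : AffineProper (homExt h) (homExt h) :=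
  affineProper_homExt hc hc fun t _ v hv => by simpa using hne v hv

variable [MeasurableSpace E] [BorelSpace E] (μ : Measure E) [μ.IsAddHaarMeasure]

theorem HasProperDegree.homExt_of_affine {h₀ h₁ : E → E} (hc₀ : ContinuousOn h₀ (sphere 0 1))
    (hc₁ : ContinuousOn h₁ (sphere 0 1))
    (hne : ∀ t ∈ Icc (0 : ℝ) 1, ∀ v ∈ sphere (0 : E) 1, h₀ v + t • (h₁ v - h₀ v) ≠ 0) {d : ℤ}
    (hd : HasProperDegree μ (homExt h₀) d) : HasProperDegree μ (homExt h₁) d :=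
  hd.of_affineProper μ (affineProper_homExt hc₀ hc₁ hne) (continuous_homExt hc₁)

/-- Reduction to straight segments: by uniform continuity, `h t` and `h t'` at nearby times differ
by less than the minimum `c` of `‖h‖`, so the segment between them avoids zero. -/
theorem HasProperDegree.homExt_of_homotopy {h : ℝ → E → E}
    (hc : ContinuousOn (Function.uncurry h) (Icc (0 : ℝ) 1 ×ˢ sphere 0 1))
    (hne : ∀ t ∈ Icc (0 : ℝ) 1, ∀ v ∈ sphere (0 : E) 1, h t v ≠ 0) {d : ℤ}
    (hd : HasProperDegree μ (homExt (h 0)) d) : HasProperDegree μ (homExt (h 1)) d := by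
  have hcomp : IsCompact (Icc (0 : ℝ) 1 ×ˢ sphere (0 : E) 1) :=
    isCompact_Icc.prod (isCompact_sphere (0 : E) 1)
  obtain ⟨c, hc0, hcle⟩ := hcomp.exists_forall_le' hc.norm
    (a := 0) fun p hp => norm_pos_iff.2 (hne p.1 hp.1 p.2 hp.2)
  obtain ⟨δ, hδ, hδc⟩ := Metric.uniformContinuousOn_iff.1
    (hcomp.uniformContinuousOn_of_continuous hc) c hc0
  have hct : ∀ t ∈ Icc (0 : ℝ) 1, ContinuousOn (h t) (sphere 0 1) := fun t ht =>
    hc.comp (f := fun v => (t, v)) (by fun_prop) fun v hv => ⟨ht, hv⟩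
  have key : ∀ t ∈ Icc (0 : ℝ) 1, ∀ t' ∈ Icc (0 : ℝ) 1, dist t t' < δ →
      HasProperDegree μ (homExt (h t)) d → HasProperDegree μ (homExt (h t')) d := by
    intro t ht t' ht' htt
    refine HasProperDegree.homExt_of_affine μ (hct t ht) (hct t' ht') fun r hr v hv h0 => ?_
    have h1 := hcle (t, v) ⟨ht, hv⟩
    have h2 := hδc (t', v) ⟨ht', hv⟩ (t, v) ⟨ht, hv⟩ (by
      rw [Prod.dist_eq, dist_self, dist_comm]
      exact max_lt htt hδ)
    simp only [Function.uncurry_apply_pair, dist_eq_norm] at h1 h2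
    rw [eq_neg_of_add_eq_zero_left h0, norm_neg, norm_smul, Real.norm_of_nonneg hr.1] at h1
    exact absurd h1 (not_le.2 ((mul_le_of_le_one_left (norm_nonneg _) hr.2).trans_lt h2))
  -- Having degree `d` is locally constant in time, and `[0, 1]` is connected.
  refine isPreconnected_Icc.induction₂' (s := Icc (0 : ℝ) 1)
    (fun t t' => HasProperDegree μ (homExt (h t)) d → HasProperDegree μ (homExt (h t')) d)
    (fun t ht => ?_) (fun _ _ _ _ _ _ h1 h2 => h2 ∘ h1) (x := 0) (y := 1) (by simp) (by simp) hd
  filter_upwards [self_mem_nhdsWithin, mem_nhdsWithin_of_mem_nhds (ball_mem_nhds t hδ)] with t' ht' hb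
  exact ⟨key t ht t' ht' (by rwa [dist_comm]), key t' ht' t ht hb⟩

theorem exists_hasProperDegree_homExt {h : E → E} (hc : ContinuousOn h (sphere 0 1))
    (hne : ∀ v ∈ sphere (0 : E) 1, h v ≠ 0) : ∃ d, HasProperDegree μ (homExt h) d :=
  exists_hasProperDegree μ (continuous_homExt hc) (affineProper_homExt_self hc hne)

end Homogeneous

/-! ### Degree of the identity, of linear conjugates and of products with the identity. -/

section Operations

theorem HasProperDegree.id {E : Type*} [NormedAddCommGroup E] [NormedSpace ℝ E]
    [MeasurableSpace E] (μ : Measure E) : HasProperDegree μ (fun v => v) 1 :=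
  ⟨fun v => v, contDiff_id, ⟨0, by simp⟩, fun φ _ _ => by simp [ContinuousLinearMap.det]⟩

variable {E : Type*} [NormedAddCommGroup E] [NormedSpace ℝ E] [FiniteDimensional ℝ E]
  [MeasurableSpace E] [BorelSpace E] (μ : Measure E) [μ.IsAddHaarMeasure]
  {E' : Type*} [NormedAddCommGroup E'] [NormedSpace ℝ E'] [FiniteDimensional ℝ E']
  [MeasurableSpace E'] [BorelSpace E'] (μ' : Measure E') [μ'.IsAddHaarMeasure]

/-- `L` and `L'` are independent maps between two different spaces, so neither has a determinant of
its own; only the sign of `det (L ∘ L')` is meaningful. -/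
theorem HasProperDegree.linear_conj {F : E' → E'} {d : ℤ} (hd : HasProperDegree μ' F d)
    (L' : E ≃L[ℝ] E') (L : E' ≃L[ℝ] E) :
    HasProperDegree μ (fun v => L (F (L' v)))
      (SignType.sign (LinearMap.det ((L'.trans L).toLinearEquiv : E →ₗ[ℝ] E)) * d) := by
  obtain ⟨G, hG, ⟨C, hC⟩, h⟩ := hd
  set T : E →ₗ[ℝ] E := ((L'.trans L).toLinearEquiv : E →ₗ[ℝ] E) with hT
  have hT0 : LinearMap.det T ≠ 0 := (LinearEquiv.isUnit_det' _).ne_zero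
  refine ⟨fun v => L (G (L' v)), ?_, ⟨‖(L : E' →L[ℝ] E)‖ * C, fun v => ?_⟩, fun φ hφ hc => ?_⟩
  · exact L.contDiff.comp (hG.comp L'.contDiff)
  · rw [← map_sub]
    exact ((L : E' →L[ℝ] E).le_opNorm _).trans (by gcongr; exact hC _)
  have hdet : ∀ v, (fderiv ℝ (fun v => L (G (L' v))) v).det =
      (fderiv ℝ G (L' v)).det * LinearMap.det T := by
    intro v
    have h1 : HasFDerivAt (fun v => L (G (L' v)))
        ((L : E' →L[ℝ] E) ∘L (fderiv ℝ G (L' v)) ∘L (L' : E →L[ℝ] E')) v :=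
      (L : E' →L[ℝ] E).hasFDerivAt.comp v
        ((hG.differentiable (by simp) _).hasFDerivAt.comp v (L' : E →L[ℝ] E').hasFDerivAt)
    rw [h1.fderiv, ContinuousLinearMap.det, ContinuousLinearMap.det,
      ← LinearMap.det_conj (fderiv ℝ G (L' v) : E' →ₗ[ℝ] E') L.toLinearEquiv, ← LinearMap.det_comp]
    congr 1
    ext w
    simp [hT]
  -- The Haar measures of the two spaces are not normalised against each other. The constant `κ`
  -- occurs in both integrals and drops out, once `∫ φ ∘ T` is evaluated through `det T`.
  obtain ⟨κ, hκ⟩ : ∃ κ : NNReal, μ.map L' = κ • μ' := ⟨_, Measure.isAddLeftInvariant_eq_smul _ _⟩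
  have hmap : ∀ g : E' → ℝ, ∫ v, g (L' v) ∂μ = (κ : ℝ) * ∫ w, g w ∂μ' := by
    intro g
    have h2 : ∫ v, g (L' v) ∂μ = ∫ w, g w ∂(μ.map L') :=
      (L'.toHomeomorph.measurableEmbedding.integral_map g).symm
    rw [h2, hκ, integral_smul_nnreal_measure]
    rfl
  have hTmap : ∫ v, φ (T v) ∂μ = |(LinearMap.det T)⁻¹| * ∫ v, φ v ∂μ := by
    have h2 : ∫ v, φ (T v) ∂μ = ∫ w, φ w ∂(μ.map T) :=
      ((L'.trans L).toHomeomorph.measurableEmbedding.integral_map φ).symm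
    rw [h2, Measure.map_linearMap_addHaar_eq_smul_addHaar μ hT0, integral_smul_measure,
      ENNReal.toReal_ofReal (abs_nonneg _), smul_eq_mul]
  have hφL : ∫ v, φ (T v) ∂μ = _ := hmap fun w => φ (L w)
  have h3 := h (fun w => φ (L w)) (hφ.comp L.contDiff) (hc.comp_homeomorph L.toHomeomorph)
  simp only [hdet]
  calc ∫ v, φ (L (G (L' v))) * ((fderiv ℝ G (L' v)).det * LinearMap.det T) ∂μ
      = LinearMap.det T * ∫ v, φ (L (G (L' v))) * (fderiv ℝ G (L' v)).det ∂μ := by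
        rw [← integral_const_mul]
        refine integral_congr_ae (ae_of_all _ fun v => ?_)
        ring
    _ = LinearMap.det T * (|(LinearMap.det T)⁻¹| * (d * ∫ v, φ v ∂μ)) := by
        rw [hmap fun w => φ (L (G w)) * (fderiv ℝ G w).det, h3, mul_left_comm _ (d : ℝ),
          ← hφL, hTmap]
        ring
    _ = _ := by
        have h4 : LinearMap.det T * |(LinearMap.det T)⁻¹| =
            ((SignType.sign (LinearMap.det T) : ℤ) : ℝ) := by
          rcases lt_or_gt_of_ne hT0 with h | h
          · rw [abs_inv, abs_of_neg h, sign_neg h]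
            field_simp
            simp
          · rw [abs_inv, abs_of_pos h, sign_pos h]
            field_simp
            simp
        push_cast at h4 ⊢
        rw [← h4]
        ring

/-- The derivative is block diagonal with an identity block, so Fubini reduces to the integral
formula on each slice `E × {y}`. -/
theorem HasProperDegree.prod_id {F : E → E} {d : ℤ} (hd : HasProperDegree μ F d)
    (hp : AffineProper F F) :
    HasProperDegree (μ.prod μ') (fun p : E × E' => (F p.1, p.2)) d := by
  obtain ⟨G, hG, ⟨C, hC⟩, h⟩ := hd
  refine ⟨fun p => (G p.1, p.2), by fun_prop, ⟨C, fun p => ?_⟩, fun φ hφ hc => ?_⟩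
  · simp [Prod.norm_def, hC]
  have hpr := (hp.of_bounded hC hC).isProperMap hG.continuous
  have hdet : ∀ p : E × E', (fderiv ℝ (fun p : E × E' => (G p.1, p.2)) p).det =
      (fderiv ℝ G p.1).det := by
    intro p
    have h1 : HasFDerivAt (fun p : E × E' => (G p.1, p.2))
        ((fderiv ℝ G p.1).prodMap (ContinuousLinearMap.id ℝ E')) p :=
      (hG.differentiable (by simp) p.1).hasFDerivAt.prodMap p (hasFDerivAt_id p.2)
    rw [h1.fderiv, ContinuousLinearMap.det, ContinuousLinearMap.det]
    have : (((fderiv ℝ G p.1).prodMap (ContinuousLinearMap.id ℝ E') : E × E' →L[ℝ] E × E') :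
      E × E' →ₗ[ℝ] E × E') = (fderiv ℝ G p.1 : E →ₗ[ℝ] E).prodMap LinearMap.id := by
      ext <;> simp
    rw [this, LinearMap.det_prodMap]
    simp
  have hdc : Continuous fun v => (fderiv ℝ G v).det :=
    ContinuousLinearMap.continuous_det.comp (hG.continuous_fderiv (by simp))
  simp only [hdet]
  have hi : Integrable (fun p : E × E' => φ (G p.1, p.2) * (fderiv ℝ G p.1).det) (μ.prod μ') := by
    refine Continuous.integrable_of_hasCompactSupport ?_ ?_
    · have := hG.continuous
      exact (hφ.continuous.comp (by fun_prop)).mul (hdc.comp continuous_fst)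
    · refine HasCompactSupport.intro (K := (G ⁻¹' (Prod.fst '' tsupport φ)) ×ˢ
        (Prod.snd '' tsupport φ)) ((hpr.isCompact_preimage (hc.image continuous_fst)).prod
          (hc.image continuous_snd)) ?_
      intro p hp
      have : (G p.1, p.2) ∉ tsupport φ := fun h => hp ⟨⟨_, h, rfl⟩, ⟨_, h, rfl⟩⟩
      simp [image_eq_zero_of_notMem_tsupport this]
  rw [integral_prod_symm _ hi, integral_prod_symm _ (hφ.continuous.integrable_of_hasCompactSupport hc),
    ← integral_const_mul]
  refine integral_congr_ae (ae_of_all _ fun y => ?_)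
  refine h (fun v => φ (v, y)) (by fun_prop) ?_
  exact HasCompactSupport.intro (hc.image continuous_fst) fun v hv =>
    image_eq_zero_of_notMem_tsupport fun h => hv ⟨_, h, rfl⟩

end Operations
end

noncomputable section

/-! ### Comparison with the degree of maps of spheres -/

section SphereDegree

theorem continuousOn_sphere_of_eq {E : Type*} [NormedAddCommGroup E] {X : Type*} [TopologicalSpace X] {h : E → X}
    {g : sphere (0 : E) 1 → X} (hg : Continuous g) (hh : ∀ x : sphere (0 : E) 1, h x = g x) :
    ContinuousOn h (sphere 0 1) := by
  rw [continuousOn_iff_continuous_domRestrict]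
  exact hg.congr fun x => (hh x).symm

variable {E : Type*} [NormedAddCommGroup E] [InnerProductSpace ℝ E]

theorem coneExtension_coe (g : C(sphere (0 : E) 1, sphere (0 : E) 1)) (x : sphere (0 : E) 1) :
    coneExtension g x = g x := by
  have hx : (x : E) ≠ 0 := ne_zero_of_mem_unit_sphere x
  have h1 : ‖(x : E)‖ = 1 := norm_eq_of_mem_sphere x
  have h2 : (⟨‖(x : E)‖⁻¹ • (x : E), norm_inv_smul_mem_sphere hx⟩ : sphere (0 : E) 1) = x := by
    ext
    simp [h1]
  rw [coneExtension, dif_neg hx, h2, h1, one_smul]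

theorem coneExtension_eq_homExt (g : C(sphere (0 : E) 1, sphere (0 : E) 1)) {h : E → E}
    (hh : ∀ x : sphere (0 : E) 1, h x = g x) : coneExtension g = homExt h := by
  ext v
  rw [coneExtension, homExt]
  split_ifs with hv
  · simp [hv]
  · rw [← hh]

theorem norm_coneExtension (g : C(sphere (0 : E) 1, sphere (0 : E) 1)) (v : E) :
    ‖coneExtension g v‖ = ‖v‖ := by
  rw [coneExtension]
  split_ifs with hv
  · simp [hv]
  · rw [norm_smul, norm_eq_of_mem_sphere, norm_norm, mul_one]

theorem coneExtension_smul (g : C(sphere (0 : E) 1, sphere (0 : E) 1)) {r : ℝ} (hr : 0 < r)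
    (v : E) : coneExtension g (r • v) = r • coneExtension g v := by
  have h := coneExtension_eq_homExt g (coneExtension_coe g)
  rw [h, homExt, homExt, norm_smul, Real.norm_of_nonneg hr.le, smul_smul, smul_smul, mul_inv,
    mul_right_comm, inv_mul_cancel₀ hr.ne', one_mul]

theorem continuousOn_coneExtension (g : C(sphere (0 : E) 1, sphere (0 : E) 1)) :
    ContinuousOn (coneExtension g) (sphere 0 1) :=
  continuousOn_sphere_of_eq (continuous_subtype_val.comp g.continuous) (coneExtension_coe g)

theorem fderiv_coneExtension_smul (g : C(sphere (0 : E) 1, sphere (0 : E) 1)) {r : ℝ}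
    (hr : 0 < r) (v : E) :
    fderiv ℝ (coneExtension g) (r • v) = fderiv ℝ (coneExtension g) v := by
  have h : (fun v => coneExtension g (r • v)) = r • coneExtension g :=
    funext fun v => coneExtension_smul g hr v
  have h1 := fderiv_comp_smul (𝕜 := ℝ) (f := coneExtension g) (x := v) r
  rw [h, fderiv_const_smul_field] at h1
  exact (smul_right_injective _ hr.ne' h1).symm

/-- The projection to the unit sphere of a nowhere zero continuous map. -/
def normalizeMap {X : Type*} [TopologicalSpace X] (h : X → E) (hc : Continuous h)
    (hne : ∀ x, h x ≠ 0) : C(X, sphere (0 : E) 1) where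
  toFun x := ⟨‖h x‖⁻¹ • h x, norm_inv_smul_mem_sphere (hne x)⟩
  continuous_toFun := Continuous.subtype_mk
    ((hc.norm.inv₀ fun x => norm_ne_zero_iff.2 (hne x)).smul hc) _

variable [FiniteDimensional ℝ E]

theorem affineProper_coneExtension (g : C(sphere (0 : E) 1, sphere (0 : E) 1)) :
    AffineProper (coneExtension g) (coneExtension g) := by
  rw [coneExtension_eq_homExt g (coneExtension_coe g)]
  refine affineProper_homExt_self (continuousOn_coneExtension g) fun v hv h0 => ?_
  have := norm_coneExtension g v
  rw [h0, norm_zero, mem_sphere_zero_iff_norm.1 hv] at this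
  exact zero_ne_one this

theorem continuous_coneExtension (g : C(sphere (0 : E) 1, sphere (0 : E) 1)) :
    Continuous (coneExtension g) := by
  rw [coneExtension_eq_homExt g (coneExtension_coe g)]
  exact continuous_homExt (continuousOn_coneExtension g)

variable [MeasurableSpace E] [BorelSpace E]

theorem HasProperDegree.of_homotopic {f g : C(sphere (0 : E) 1, sphere (0 : E) 1)}
    (h : f.Homotopic g) (μ : Measure E) [μ.IsAddHaarMeasure] {d : ℤ}
    (hd : HasProperDegree μ (coneExtension f) d) : HasProperDegree μ (coneExtension g) d := by
  obtain ⟨F⟩ := h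
  have h0 : coneExtension f = homExt (coneExtension (F.curry 0)) :=
    coneExtension_eq_homExt f fun x => by rw [coneExtension_coe]; simp
  have h1 : coneExtension g = homExt (coneExtension (F.curry 1)) :=
    coneExtension_eq_homExt g fun x => by rw [coneExtension_coe]; simp
  rw [h0] at hd
  rw [h1]
  have := HasProperDegree.homExt_of_homotopy μ (d := d)
    (h := fun t => coneExtension (F.curry (projIcc 0 1 zero_le_one t))) ?_ ?_ (by simpa using hd)
  · simpa using this
  · rw [continuousOn_iff_continuous_domRestrict]
    have hc : Continuous fun p : ↥(Icc (0 : ℝ) 1 ×ˢ sphere (0 : E) 1) =>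
        (F (⟨p.1.1, p.2.1⟩, ⟨p.1.2, p.2.2⟩) : E) := by fun_prop
    refine hc.congr fun p => ?_
    simp only [domRestrict_apply, Function.uncurry_def]
    rw [projIcc_of_mem zero_le_one p.2.1]
    exact (coneExtension_coe (F.curry ⟨p.1.1, p.2.1⟩) ⟨p.1.2, p.2.2⟩).symm
  · intro t _ v hv h0
    have := norm_coneExtension (F.curry (projIcc 0 1 zero_le_one t)) v
    rw [h0, norm_zero, mem_sphere_zero_iff_norm.1 hv] at this
    exact zero_ne_one this

theorem integral_norm_mul_of_homogeneous (μ : Measure E) [μ.IsAddHaarMeasure] [Nontrivial E]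
    (a : ℝ → ℝ) {J : E → ℝ} (hJ : ∀ r : ℝ, 0 < r → ∀ v, J (r • v) = J v) :
    ∫ v, a ‖v‖ * J v ∂μ = (∫ x : sphere (0 : E) 1, J x ∂μ.toSphere) *
      ∫ r : Ioi (0 : ℝ), a r ∂.volumeIoiPow (Module.finrank ℝ E - 1) := by
  calc
    ∫ v, a ‖v‖ * J v ∂μ
        = ∫ x : ({(0)}ᶜ : Set E), a ‖x.1‖ * J x.1 ∂(μ.comap (↑)) := by
      rw [integral_subtype_comap (measurableSet_singleton _).compl fun v => a ‖v‖ * J v,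
        restrict_compl_singleton]
    _ = ∫ x : sphere (0 : E) 1 × Ioi (0 : ℝ), J x.1 * a x.2
          ∂μ.toSphere.prod (.volumeIoiPow (Module.finrank ℝ E - 1)) := by
      have h := μ.measurePreserving_homeomorphUnitSphereProd.integral_comp
        (Homeomorph.measurableEmbedding _)
        (fun x : sphere (0 : E) 1 × Ioi (0 : ℝ) => J x.1 * a x.2)
      rw [← h]
      refine integral_congr_ae (ae_of_all _ fun x => ?_)
      have hx : 0 < ‖x.1‖ := norm_pos_iff.2 x.2
      simp only [homeomorphUnitSphereProd_apply_fst_coe, homeomorphUnitSphereProd_apply_snd_coe]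
      rw [hJ _ (inv_pos.2 hx), mul_comm]
    _ = _ := integral_prod_mul (fun x : sphere (0 : E) 1 => J x) fun r : Ioi (0 : ℝ) => a r

/-- The Jacobian of the cone extension is homogeneous of degree zero and the extension preserves
norms. With a radial test function, polar coordinates give both sides of the degree formula the same
positive radial factor, which cancels. -/
theorem HasProperDegree.integral_det_fderiv_coneExtension [Nontrivial E] (μ : Measure E)
    [μ.IsAddHaarMeasure] {g : C(sphere (0 : E) 1, sphere (0 : E) 1)}
    (hg : ContDiffOn ℝ ∞ (coneExtension g) {0}ᶜ) {d : ℤ}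
    (hd : HasProperDegree μ (coneExtension g) d) :
    ∫ x : sphere (0 : E) 1, (fderiv ℝ (coneExtension g) x).det ∂μ.toSphere =
      d * μ.toSphere.real univ := by
  -- `ψ(‖v‖²)` vanishes when `‖v‖ ≤ 1` and when `‖v‖ > 2`, so the test function does not see the
  -- region where the cone extension is modified.
  let ψ : ContDiffBump (2 : ℝ) := ⟨1 / 4, 1 / 2, by norm_num, by norm_num⟩
  have hψ0 : ∀ r : ℝ, r ≤ 1 → ψ r = 0 := fun r hr => by
    refine ψ.zero_of_le_dist ?_
    change 1 / 2 ≤ _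
    rw [Real.dist_eq, abs_of_nonpos (by linarith)]
    linarith
  let φ : E → ℝ := fun v => ψ (‖v‖ ^ 2)
  have hφ : ContDiff ℝ ∞ φ := ψ.contDiff.comp (contDiff_norm_sq ℝ)
  have hφc : HasCompactSupport φ := by
    refine HasCompactSupport.intro (isCompact_closedBall (0 : E) 2) fun v hv => ?_
    rw [mem_closedBall_zero_iff, not_le] at hv
    refine ψ.zero_of_le_dist ?_
    change 1 / 2 ≤ _
    rw [Real.dist_eq, abs_of_nonneg (by nlinarith)]
    nlinarith
  -- The cone extension need not be smooth at the origin; `χ` vanishes for `‖v‖² ≤ 1/2` and is `1`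
  -- for `‖v‖ ≥ 1`.
  let χ : E → ℝ := fun v => Real.smoothTransition (2 * ‖v‖ ^ 2 - 1)
  have hχ : ContDiff ℝ ∞ χ :=
    Real.smoothTransition.contDiff.comp ((contDiff_const.mul (contDiff_norm_sq ℝ)).sub contDiff_const)
  let G : E → E := fun v => χ v • coneExtension g v
  have hG : ContDiff ℝ ∞ G := by
    refine contDiff_iff_contDiffAt.2 fun v => ?_
    rcases eq_or_ne v 0 with rfl | hv
    · have h0 : G =ᶠ[𝓝 0] fun _ => 0 := by
        filter_upwards [ball_mem_nhds (0 : E) (show (0 : ℝ) < 1 / 2 by norm_num)] with v hv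
        rw [mem_ball_zero_iff] at hv
        have : χ v = 0 := Real.smoothTransition.zero_of_nonpos (by nlinarith [norm_nonneg v])
        simp [G, this]
      exact contDiffAt_const.congr_of_eventuallyEq h0
    · exact hχ.contDiffAt.smul (hg.contDiffAt (isOpen_compl_singleton.mem_nhds hv))
  have hG1 : ∀ v, 1 ≤ ‖v‖ → G v = coneExtension g v := fun v hv => by
    have : χ v = 1 := Real.smoothTransition.one_of_one_le (by nlinarith)
    simp [G, this]
  have hGle : ∀ v, ‖G v‖ ≤ ‖v‖ := fun v => by
    rw [norm_smul, norm_coneExtension, Real.norm_of_nonneg (Real.smoothTransition.nonneg _)]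
    exact mul_le_of_le_one_left (norm_nonneg _) (Real.smoothTransition.le_one _)
  have hbd : ∀ v, ‖G v - coneExtension g v‖ ≤ 2 := fun v => by
    rcases le_total 1 ‖v‖ with hv | hv
    · simp [hG1 v hv]
    · have := hGle v
      have := norm_sub_le (G v) (coneExtension g v)
      rw [norm_coneExtension] at this
      linarith
  have h1 := hd.integral_eq μ hG
    ((affineProper_coneExtension g).of_bounded (C₀ := 0) (by simp) hbd) hφ hφc
  have h2 : ∀ v, φ (G v) * (fderiv ℝ G v).det =
      ψ (‖v‖ ^ 2) * (fderiv ℝ (coneExtension g) v).det := by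
    intro v
    rcases lt_or_ge 1 ‖v‖ with hv | hv
    · have he : G =ᶠ[𝓝 v] coneExtension g := by
        filter_upwards [(isOpen_lt continuous_const continuous_norm).mem_nhds hv] with w hw
        exact hG1 w hw.le
      rw [he.fderiv_eq]
      simp [φ, hG1 v hv.le, norm_coneExtension]
    · have e1 : φ (G v) = 0 := hψ0 _ (by nlinarith [hGle v, norm_nonneg (G v)])
      have e2 : ψ (‖v‖ ^ 2) = 0 := hψ0 _ (by nlinarith [norm_nonneg v])
      simp [e1, e2]
  simp only [h2] at h1
  have h3 := integral_norm_mul_of_homogeneous μ (fun r => ψ (r ^ 2))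
    (J := fun v => (fderiv ℝ (coneExtension g) v).det)
    fun r hr v => by rw [fderiv_coneExtension_smul g hr]
  have h4 := integral_norm_mul_of_homogeneous μ (fun r => ψ (r ^ 2)) (J := fun _ => 1)
    fun r hr v => rfl
  simp only [mul_one, integral_const, smul_eq_mul] at h4
  have hpos : 0 < ∫ v, φ v ∂μ := by
    obtain ⟨v, hv⟩ := exists_norm_eq E (Real.sqrt_nonneg 2)
    refine hφ.continuous.integral_pos_of_hasCompactSupport_nonneg_nonzero hφc
      (fun v => ψ.nonneg) (x := v) ?_
    have : φ v = 1 := by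
      simp only [φ, hv]
      refine ψ.one_of_mem_closedBall ?_
      rw [Real.sq_sqrt (by norm_num)]
      exact mem_closedBall_self (by norm_num [ψ])
    rw [this]
    exact one_ne_zero
  rw [h3, show (∫ v, φ v ∂μ) = _ from h4] at h1
  rw [show (∫ v, φ v ∂μ) = _ from h4] at hpos
  refine mul_right_cancel₀ (right_ne_zero_of_mul hpos.ne') (h1.trans ?_)
  ring

/-- In one direction, the smooth representative has some proper degree, which the spherical integral
identifies because the sphere has nonzero measure. In the other, a smooth representative must be
constructed from `f`. -/
theorem hasDegree_iff_hasProperDegree [Nontrivial E]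
    (f : C(sphere (0 : E) 1, sphere (0 : E) 1)) (d : ℤ) :
    HasDegree f d ↔ HasProperDegree volume (coneExtension f) d := by
  constructor
  · rintro ⟨g, hg, hfg, hI⟩
    obtain ⟨d', hd'⟩ := exists_hasProperDegree volume (continuous_coneExtension g)
      (affineProper_coneExtension g)
    have h := hd'.integral_det_fderiv_coneExtension volume hg
    rw [hI] at h
    have hpos : (volume : Measure E).toSphere.real univ ≠ 0 := by
      rw [measureReal_ne_zero_iff, Measure.measure_univ_ne_zero]
      exact Measure.toSphere_ne_zero (volume : Measure E)
    have : d = d' := by exact_mod_cast mul_right_cancel₀ hpos h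
    exact HasProperDegree.of_homotopic hfg.symm volume (this ▸ hd')
  · intro hd
    -- An error below `1/2` is less than `‖f‖ = 1`, so the segments from `f` to `G` avoid zero on
    -- the sphere and `G` can be normalised along them.
    obtain ⟨G, hG, hfG, -⟩ := (continuous_coneExtension f).exists_contDiff_approx
      (ε := fun _ => 1 / 2) ⊤ continuous_const (by norm_num)
    have hline : ∀ p : unitInterval × sphere (0 : E) 1,
        (f p.2 : E) + (p.1 : ℝ) • (G p.2 - f p.2) ≠ 0 := by
      rintro ⟨t, x⟩ h0
      have h1 := hfG x
      rw [coneExtension_coe, dist_eq_norm] at h1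
      have h2 := norm_eq_of_mem_sphere (f x)
      rw [eq_neg_of_add_eq_zero_left h0, norm_neg, norm_smul, Real.norm_of_nonneg t.2.1] at h2
      have := mul_le_of_le_one_left (norm_nonneg (G x - f x)) t.2.2
      simp only at h2
      linarith
    have hGne : ∀ x : sphere (0 : E) 1, G x ≠ 0 := fun x => by simpa using hline (1, x)
    let g : C(sphere (0 : E) 1, sphere (0 : E) 1) :=
      normalizeMap (fun x : sphere (0 : E) 1 => G x) (hG.continuous.comp continuous_subtype_val) hGne
    have hfg : f.Homotopic g := by
      refine ⟨⟨normalizeMap (fun p : unitInterval × sphere (0 : E) 1 =>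
        (f p.2 : E) + (p.1 : ℝ) • (G p.2 - f p.2)) ?_ hline, fun x => ?_, fun x => ?_⟩⟩
      · have := hG.continuous
        fun_prop
      · ext
        simp [normalizeMap]
      · ext
        simp only [normalizeMap, g, ContinuousMap.coe_mk, Set.Icc.coe_one, one_smul,
          add_sub_cancel]
    have hgs : ContDiffOn ℝ ∞ (coneExtension g) {0}ᶜ := by
      have hns : ContDiffOn ℝ ∞ (fun v : E => ‖v‖) {0}ᶜ := fun v hv =>
        (contDiffAt_norm ℝ hv).contDiffWithinAt
      have hw : ContDiffOn ℝ ∞ (fun v : E => G (‖v‖⁻¹ • v)) {0}ᶜ :=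
        hG.comp_contDiffOn ((hns.inv fun v hv => norm_ne_zero_iff.2 hv).smul contDiffOn_id)
      have hw0 : ∀ v ∈ ({0}ᶜ : Set E), G (‖v‖⁻¹ • v) ≠ 0 := fun v hv =>
        hGne ⟨_, norm_inv_smul_mem_sphere hv⟩
      refine (hns.smul (((hw.norm ℝ hw0).inv fun v hv =>
        norm_ne_zero_iff.2 (hw0 v hv)).smul hw)).congr fun v hv => ?_
      rw [coneExtension, dif_neg (show v ≠ 0 from hv)]
      rfl
    exact ⟨g, hgs, hfg, (hd.of_homotopic hfg volume).integral_det_fderiv_coneExtension volume hgs⟩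

end SphereDegree
end

noncomputable section

/-! ### The local degree at an isolated zero -/

section LocalDegree

variable {E : Type*} [NormedAddCommGroup E]

theorem add_smul_mem_closedBall_diff [NormedSpace ℝ E] {a v : E} {r ε : ℝ} (hε : 0 < ε)
    (hεr : ε ≤ r) (hv : v ∈ sphere (0 : E) 1) : a + ε • v ∈ closedBall a r \ {a} := by
  have hv1 : ‖v‖ = 1 := mem_sphere_zero_iff_norm.1 hv
  refine ⟨?_, fun h => ?_⟩
  · rw [mem_closedBall, dist_eq_norm, add_sub_cancel_left, norm_smul, hv1, mul_one,
      Real.norm_of_nonneg hε.le]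
    exact hεr
  · rw [mem_singleton_iff, add_eq_left, smul_eq_zero] at h
    rcases h with h | h
    · exact hε.ne' h
    · rw [h, norm_zero] at hv1
      exact zero_ne_one hv1

theorem HasProperDegree.homExt_of_pos_smul [NormedSpace ℝ E] [FiniteDimensional ℝ E]
    [MeasurableSpace E] [BorelSpace E] (μ : Measure E) [μ.IsAddHaarMeasure] {h₀ h₁ : E → E}
    (hc₀ : ContinuousOn h₀ (sphere 0 1)) (hc₁ : ContinuousOn h₁ (sphere 0 1))
    (hne : ∀ v ∈ sphere (0 : E) 1, h₀ v ≠ 0)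
    (hpos : ∀ v ∈ sphere (0 : E) 1, ∃ c : ℝ, 0 < c ∧ h₁ v = c • h₀ v) {d : ℤ}
    (hd : HasProperDegree μ (homExt h₀) d) : HasProperDegree μ (homExt h₁) d := by
  refine hd.homExt_of_affine μ hc₀ hc₁ fun t ht v hv => ?_
  obtain ⟨c, hc, hcv⟩ := hpos v hv
  have e : h₀ v + t • (h₁ v - h₀ v) = ((1 - t) + t * c) • h₀ v := by rw [hcv]; module
  rw [e]
  refine smul_ne_zero (ne_of_gt ?_) (hne v hv)
  rcases eq_or_lt_of_le ht.1 with rfl | h0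
  · simp
  · have := mul_pos h0 hc
    linarith [ht.2]

variable [InnerProductSpace ℝ E] [FiniteDimensional ℝ E] [MeasurableSpace E] [BorelSpace E]

section

variable {F : E → E} {a : E} {r : ℝ} (hc : ContinuousOn F (closedBall a r \ {a}))
  (hne : ∀ u ∈ closedBall a r \ {a}, F u ≠ 0) {d : ℤ}

include hc

omit [FiniteDimensional ℝ E] [MeasurableSpace E] [BorelSpace E] in
theorem continuousOn_comp_add_smul {ε : ℝ} (hε : 0 < ε) (hεr : ε ≤ r) :
    ContinuousOn (fun v => F (a + ε • v)) (sphere 0 1) :=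
  hc.comp (f := fun v => a + ε • v) (by fun_prop) fun _ hv => add_smul_mem_closedBall_diff hε hεr hv

include hne

theorem HasProperDegree.change_radius (μ : Measure E) [μ.IsAddHaarMeasure] {ε ε' : ℝ} (hε : 0 < ε)
    (hεr : ε ≤ r) (hε' : 0 < ε') (hεr' : ε' ≤ r)
    (hd : HasProperDegree μ (homExt fun v => F (a + ε • v)) d) :
    HasProperDegree μ (homExt fun v => F (a + ε' • v)) d := by
  have hmem : ∀ t ∈ Icc (0 : ℝ) 1, 0 < (1 - t) * ε + t * ε' ∧ (1 - t) * ε + t * ε' ≤ r := by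
    intro t ht
    have h1 := (convex_Icc (min ε ε') r) ⟨min_le_left _ _, hεr⟩ ⟨min_le_right _ _, hεr'⟩
      (sub_nonneg.2 ht.2) ht.1 (sub_add_cancel 1 t)
    exact ⟨(lt_min hε hε').trans_le h1.1, h1.2⟩
  have := HasProperDegree.homExt_of_homotopy μ
    (h := fun t v => F (a + ((1 - t) * ε + t * ε') • v)) (d := d) ?_ ?_ (by simpa using hd)
  · simpa using this
  · refine hc.comp (f := fun p : ℝ × E => a + ((1 - p.1) * ε + p.1 * ε') • p.2) (by fun_prop) ?_
    rintro ⟨t, v⟩ ⟨ht, hv⟩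
    exact add_smul_mem_closedBall_diff (hmem t ht).1 (hmem t ht).2 hv
  · exact fun t ht v hv => hne _ (add_smul_mem_closedBall_diff (hmem t ht).1 (hmem t ht).2 hv)

/-- All spheres of radius at most `r` give the same degree, so the condition on all small radii
reduces to the single radius `r`, without normalisation of `F`. -/
theorem hasLocalDegree_iff [Nontrivial E] (hr : 0 < r) :
    HasLocalDegree F a d ↔ HasProperDegree volume (homExt fun v => F (a + r • v)) d := by
  have key : ∀ ε, 0 < ε → ε ≤ r → ∀ f : C(sphere (0 : E) 1, sphere (0 : E) 1),
      (∀ v : sphere (0 : E) 1, F (a + ε • (v : E)) ≠ 0 ∧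
        (f v : E) = ‖F (a + ε • (v : E))‖⁻¹ • F (a + ε • (v : E))) →
      (HasDegree f d ↔ HasProperDegree volume (homExt fun v => F (a + r • v)) d) := by
    intro ε hε hεr f hf
    rw [hasDegree_iff_hasProperDegree, coneExtension_eq_homExt f (coneExtension_coe f)]
    have hcε := continuousOn_comp_add_smul hc hε hεr
    have hneε : ∀ v ∈ sphere (0 : E) 1, F (a + ε • v) ≠ 0 := fun v hv => (hf ⟨v, hv⟩).1
    have hfe : ∀ v (hv : v ∈ sphere (0 : E) 1), coneExtension f v = f ⟨v, hv⟩ := fun v hv =>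
      coneExtension_coe f ⟨v, hv⟩
    constructor
    · intro h
      refine HasProperDegree.change_radius hc hne volume hε hεr hr le_rfl ?_
      refine h.homExt_of_pos_smul volume (continuousOn_coneExtension f) hcε (fun v hv => ?_)
        fun v hv => ⟨‖F (a + ε • v)‖, norm_pos_iff.2 (hneε v hv), ?_⟩
      · rw [hfe v hv]
        exact ne_zero_of_mem_unit_sphere _
      · rw [hfe v hv, (hf ⟨v, hv⟩).2, smul_smul, mul_inv_cancel₀ (norm_ne_zero_iff.2 (hneε v hv)),
          one_smul]
    · intro h
      have h' := HasProperDegree.change_radius hc hne volume hr le_rfl hε hεr h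
      refine h'.homExt_of_pos_smul volume hcε (continuousOn_coneExtension f) hneε
        fun v hv => ⟨‖F (a + ε • v)‖⁻¹, inv_pos.2 (norm_pos_iff.2 (hneε v hv)), ?_⟩
      rw [hfe v hv, (hf ⟨v, hv⟩).2]
  have hev : ∀ᶠ ε in 𝓝[>] (0 : ℝ), 0 < ε ∧ ε ≤ r := by
    filter_upwards [self_mem_nhdsWithin, mem_nhdsWithin_of_mem_nhds (Iic_mem_nhds hr)] with ε h1 h2
    exact ⟨h1, h2⟩
  constructor
  · intro h
    obtain ⟨ε, ⟨f, hf, hd⟩, hε, hεr⟩ := (h.and hev).exists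
    exact (key ε hε hεr f hf).1 hd
  · intro h
    filter_upwards [hev] with ε hε
    have hcε := continuousOn_comp_add_smul hc hε.1 hε.2
    have hneε : ∀ v : sphere (0 : E) 1, F (a + ε • (v : E)) ≠ 0 := fun v =>
      hne _ (add_smul_mem_closedBall_diff hε.1 hε.2 v.2)
    let f : C(sphere (0 : E) 1, sphere (0 : E) 1) :=
      normalizeMap (fun v : sphere (0 : E) 1 => F (a + ε • (v : E)))
        (continuousOn_iff_continuous_domRestrict.1 hcε) hneε
    have hf : ∀ v : sphere (0 : E) 1, F (a + ε • (v : E)) ≠ 0 ∧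
        (f v : E) = ‖F (a + ε • (v : E))‖⁻¹ • F (a + ε • (v : E)) := fun v => ⟨hneε v, rfl⟩
    exact ⟨f, hf, (key ε hε.1 hε.2 f hf).2 h⟩

theorem exists_hasProperDegree_of_isolated (μ : Measure E) [μ.IsAddHaarMeasure] (hr : 0 < r) :
    ∃ d, HasProperDegree μ (homExt fun v => F (a + r • v)) d :=
  exists_hasProperDegree_homExt μ (continuousOn_comp_add_smul hc hr le_rfl)
    fun _ hv => hne _ (add_smul_mem_closedBall_diff hr le_rfl hv)

theorem localDegree_eq [Nontrivial E] (hr : 0 < r)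
    (hd : HasProperDegree volume (homExt fun v => F (a + r • v)) d) : localDegree F a = d := by
  have h : ∃ d, HasLocalDegree F a d := ⟨d, (hasLocalDegree_iff hc hne hr).2 hd⟩
  rw [localDegree, dif_pos h]
  refine HasProperDegree.unique volume ((hasLocalDegree_iff hc hne hr).1 h.choose_spec) hd ?_
  exact affineProper_homExt_self (continuousOn_comp_add_smul hc hr le_rfl)
    fun _ hv => hne _ (add_smul_mem_closedBall_diff hr le_rfl hv)

end

end LocalDegree
end

noncomputable section

/-! ### Invariance of the local degree of a 1-form under suspension and change of coordinates -/

section Transfer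

theorem add_smul_mem_closedBall {E₁ E₂ : Type*} [NormedAddCommGroup E₁] [NormedSpace ℝ E₁]
    [NormedAddCommGroup E₂] [NormedSpace ℝ E₂] (b : E₁) {ρ : ℝ} {y : E₁ × E₂} {c : ℝ} (hc : 0 ≤ c)
    (hcy : c * ‖y‖ ≤ ρ) : b + c • y.1 ∈ closedBall b ρ := by
  rw [mem_closedBall, dist_eq_norm, add_sub_cancel_left, norm_smul, Real.norm_of_nonneg hc]
  exact (mul_le_mul_of_nonneg_left (norm_fst_le y) hc).trans hcy

theorem suspension_ne_zero {E₁ E₂ : Type*} [NormedAddCommGroup E₁] [NormedAddCommGroup E₂]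
    [NormedSpace ℝ E₂] {G : E₁ → E₁} {b : E₁} {ρ : ℝ} (hGne : ∀ y ∈ closedBall b ρ \ {b}, G y ≠ 0)
    {p : E₁ × E₂} (hp : p ≠ 0) (hpb : b + p.1 ∈ closedBall b ρ) :
    (G (b + p.1), (2 : ℝ) • p.2) ≠ 0 := by
  intro h
  rw [Prod.mk_eq_zero, smul_eq_zero] at h
  have h2 : p.2 = 0 := by simpa using h.2
  refine hGne _ ⟨hpb, fun h1 => hp (Prod.ext ?_ h2)⟩ h.1
  simpa using h1

theorem homExt_eq_self {E : Type*} [NormedAddCommGroup E] [NormedSpace ℝ E] {F : E → E}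
    (h0 : F 0 = 0) (hF : ∀ r : ℝ, 0 < r → ∀ v, F (r • v) = r • F v) : homExt F = F := by
  ext v
  rcases eq_or_ne v 0 with rfl | hv
  · simp [homExt, h0]
  · rw [homExt, hF _ (inv_pos.2 (norm_pos_iff.2 hv)), smul_smul,
      mul_inv_cancel₀ (norm_ne_zero_iff.2 hv), one_smul]

theorem homExt_smul {E : Type*} [NormedAddCommGroup E] [NormedSpace ℝ E] (h : E → E) {r : ℝ}
    (hr : 0 < r) (v : E) : homExt h (r • v) = r • homExt h v := by
  rw [homExt, homExt, norm_smul, Real.norm_of_nonneg hr.le, smul_smul, smul_smul, mul_inv,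
    mul_right_comm, inv_mul_cancel₀ hr.ne', one_mul]

/-- Every map on the segment from the identity to `A` still satisfies the positivity condition,
hence is injective; the determinant does not vanish on the way from `1`. -/
theorem LinearMap.det_pos_of_inner_pos {E : Type*} [NormedAddCommGroup E] [InnerProductSpace ℝ E]
    [FiniteDimensional ℝ E] (A : E →ₗ[ℝ] E) (hA : ∀ w, w ≠ 0 → 0 < inner ℝ (A w) w) :
    0 < LinearMap.det A := by
  by_contra! hle
  let f : ℝ → ℝ := fun t =>
    ((1 - t) • ContinuousLinearMap.id ℝ E + t • LinearMap.toContinuousLinearMap A).det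
  have hf : Continuous f := ContinuousLinearMap.continuous_det.comp (by fun_prop)
  have h0 : f 0 = 1 := by simp [f, ContinuousLinearMap.det]
  have h1 : f 1 ≤ 0 := by simpa [f, ContinuousLinearMap.det] using hle
  obtain ⟨t, ht, hft⟩ := intermediate_value_Icc' zero_le_one hf.continuousOn
    (show (0 : ℝ) ∈ Icc (f 1) (f 0) from ⟨h1, by rw [h0]; exact zero_le_one⟩)
  have hker := LinearMap.bot_lt_ker_of_det_eq_zero hft
  obtain ⟨w, hw, hw0⟩ := (Submodule.ne_bot_iff _).1 hker.ne'
  have hw1 : (1 - t) • w + t • A w = 0 := by simpa using hw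
  have hw2 := congrArg (fun z => inner ℝ z w) hw1
  simp only [inner_add_left, real_inner_smul_left, inner_zero_left, real_inner_self_eq_norm_sq] at hw2
  have hp := hA w hw0
  have hn : 0 < ‖w‖ ^ 2 := by have := norm_pos_iff.2 hw0; positivity
  rcases eq_or_lt_of_le ht.1 with rfl | h
  · simp at hw2
    exact hw0 hw2
  · nlinarith [mul_pos h hp, mul_nonneg (sub_nonneg.2 ht.2) hn.le]

variable {E : Type*} [NormedAddCommGroup E] [InnerProductSpace ℝ E]
  {E₁ : Type*} [NormedAddCommGroup E₁] [InnerProductSpace ℝ E₁]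
  {E₂ : Type*} [NormedAddCommGroup E₂] [InnerProductSpace ℝ E₂]

/-- The pull-back by a linear map `B` of the linear form on `E₁ × E₂` with coefficients `y`. -/
def pullbackForm (B : E →L[ℝ] E₁ × E₂) (y : E₁ × E₂) : E →L[ℝ] ℝ :=
  (innerSL ℝ y.1).comp ((ContinuousLinearMap.fst ℝ E₁ E₂).comp B) +
    (innerSL ℝ y.2).comp ((ContinuousLinearMap.snd ℝ E₁ E₂).comp B)

theorem pullbackForm_apply (B : E →L[ℝ] E₁ × E₂) (y : E₁ × E₂) (w : E) :
    pullbackForm B y w = inner ℝ y.1 (B w).1 + inner ℝ y.2 (B w).2 := by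
  simp [pullbackForm]

theorem continuous_pullbackForm :
    Continuous fun p : (E →L[ℝ] E₁ × E₂) × (E₁ × E₂) => pullbackForm p.1 p.2 := by
  unfold pullbackForm
  fun_prop

theorem prod_inner_self_pos {y : E₁ × E₂} (hy : y ≠ 0) :
    0 < inner ℝ y.1 y.1 + inner ℝ y.2 y.2 := by
  by_cases h1 : y.1 = 0
  · have h2 : y.2 ≠ 0 := fun h2 => hy (Prod.ext h1 h2)
    exact add_pos_of_nonneg_of_pos real_inner_self_nonneg (real_inner_self_pos.2 h2)
  · exact add_pos_of_pos_of_nonneg (real_inner_self_pos.2 h1) real_inner_self_nonneg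

variable [CompleteSpace E]

/-- The coefficients of the pull-back by `B` of the linear form with coefficients `y`. -/
def pullbackCoeff (B : E →L[ℝ] E₁ × E₂) (y : E₁ × E₂) : E :=
  (InnerProductSpace.toDual ℝ E).symm (pullbackForm B y)

theorem inner_pullbackCoeff (B : E →L[ℝ] E₁ × E₂) (y : E₁ × E₂) (w : E) :
    inner ℝ (pullbackCoeff B y) w = inner ℝ y.1 (B w).1 + inner ℝ y.2 (B w).2 := by
  rw [pullbackCoeff, InnerProductSpace.toDual_symm_apply, pullbackForm_apply]

theorem continuous_pullbackCoeff :
    Continuous fun p : (E →L[ℝ] E₁ × E₂) × (E₁ × E₂) => pullbackCoeff p.1 p.2 :=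
  (InnerProductSpace.toDual ℝ E).symm.continuous.comp continuous_pullbackForm

theorem ContinuousOn.pullbackCoeff {X : Type*} [TopologicalSpace X] {B : X → E →L[ℝ] E₁ × E₂}
    {y : X → E₁ × E₂} {s : Set X} (hB : ContinuousOn B s) (hy : ContinuousOn y s) :
    ContinuousOn (fun x => _root_.pullbackCoeff (B x) (y x)) s := by
  have h := Continuous.comp_continuousOn (f := fun x => (B x, y x)) (s := s)
    (continuous_pullbackCoeff (E := E) (E₁ := E₁) (E₂ := E₂)) (hB.prodMk hy)
  exact h

theorem pullbackCoeff_ne_zero (B : E ≃L[ℝ] E₁ × E₂) {y : E₁ × E₂} (hy : y ≠ 0) :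
    pullbackCoeff (B : E →L[ℝ] E₁ × E₂) y ≠ 0 := by
  intro h
  have h1 := inner_pullbackCoeff (B : E →L[ℝ] E₁ × E₂) y (B.symm y)
  rw [h, inner_zero_left] at h1
  rw [ContinuousLinearEquiv.coe_coe, ContinuousLinearEquiv.apply_symm_apply] at h1
  exact (prod_inner_self_pos hy).ne h1

theorem pullbackCoeff_add (B : E →L[ℝ] E₁ × E₂) (y z : E₁ × E₂) :
    pullbackCoeff B (y + z) = pullbackCoeff B y + pullbackCoeff B z := by
  refine ext_inner_right ℝ fun w => ?_
  simp only [inner_add_left, inner_pullbackCoeff, Prod.fst_add, Prod.snd_add]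
  ring

theorem pullbackCoeff_smul (B : E →L[ℝ] E₁ × E₂) (c : ℝ) (y : E₁ × E₂) :
    pullbackCoeff B (c • y) = c • pullbackCoeff B y := by
  refine ext_inner_right ℝ fun w => ?_
  simp only [real_inner_smul_left, inner_pullbackCoeff, Prod.smul_fst, Prod.smul_snd]
  ring

variable [FiniteDimensional ℝ E] [FiniteDimensional ℝ E₁] [FiniteDimensional ℝ E₂]

/-- The transpose of an invertible linear map, with respect to the inner products. -/
def pullbackEquiv (B : E ≃L[ℝ] E₁ × E₂) : (E₁ × E₂) ≃L[ℝ] E :=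
  (LinearEquiv.ofInjectiveOfFinrankEq
    (IsLinearMap.mk' (pullbackCoeff (B : E →L[ℝ] E₁ × E₂))
      ⟨pullbackCoeff_add _, pullbackCoeff_smul _⟩)
    (by
      rw [← LinearMap.ker_eq_bot, LinearMap.ker_eq_bot']
      intro y hy
      by_contra h
      exact pullbackCoeff_ne_zero B h hy)
    B.toLinearEquiv.finrank_eq.symm).toContinuousLinearEquiv

theorem pullbackEquiv_apply (B : E ≃L[ℝ] E₁ × E₂) (y : E₁ × E₂) :
    pullbackEquiv B y = pullbackCoeff (B : E →L[ℝ] E₁ × E₂) y := rfl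

/-- The composite is `Bᵀ B`, which is positive definite. For this reason no orientation hypothesis
on the product chart is needed. -/
theorem det_pullbackEquiv_pos (B : E ≃L[ℝ] E₁ × E₂) :
    0 < LinearMap.det ((B.trans (pullbackEquiv B)).toLinearEquiv : E →ₗ[ℝ] E) := by
  refine LinearMap.det_pos_of_inner_pos _ fun w hw => ?_
  have h : B w ≠ 0 := fun h => hw (B.injective (by rw [h, map_zero]))
  change 0 < inner ℝ (pullbackEquiv B (B w)) w
  rw [pullbackEquiv_apply, inner_pullbackCoeff]
  exact prod_inner_self_pos h

variable [MeasurableSpace E] [BorelSpace E] (μ : Measure E) [μ.IsAddHaarMeasure]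
  [MeasurableSpace E₁] [BorelSpace E₁] (μ₁ : Measure E₁) [μ₁.IsAddHaarMeasure]
  [MeasurableSpace E₂] [BorelSpace E₂] (μ₂ : Measure E₂) [μ₂.IsAddHaarMeasure]

section

variable {G : E₁ → E₁} {b : E₁} {ρ : ℝ} (hρ : 0 < ρ) (hG : ContinuousOn G (closedBall b ρ))
  (hGne : ∀ y ∈ closedBall b ρ \ {b}, G y ≠ 0) {d : ℤ}

include hρ hG hGne

/-- The product of the homogeneous extension with the identity has degree `d`. It is joined to the
stated map by segments on the unit sphere of the product, which carries the maximum norm. The factor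
`2` is that of `d‖y‖²`. -/
theorem HasProperDegree.suspension
    (hd : HasProperDegree μ₁ (homExt fun v => G (b + ρ • v)) d) :
    HasProperDegree (μ₁.prod μ₂)
      (homExt fun y : E₁ × E₂ => (G (b + ρ • y.1), (2 * ρ) • y.2)) d := by
  have hc1 : ContinuousOn (fun v => G (b + ρ • v)) (sphere 0 1) :=
    continuousOn_comp_add_smul (hG.mono sdiff_subset) hρ le_rfl
  have hap : AffineProper (homExt fun v => G (b + ρ • v)) (homExt fun v => G (b + ρ • v)) :=
    affineProper_homExt_self hc1 fun _ hv => hGne _ (add_smul_mem_closedBall_diff hρ le_rfl hv)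
  have h := hd.prod_id μ₁ μ₂ hap
  have he : homExt (fun p : E₁ × E₂ => (homExt (fun v => G (b + ρ • v)) p.1, p.2)) =
      fun p => (homExt (fun v => G (b + ρ • v)) p.1, p.2) := by
    refine homExt_eq_self (by simp [homExt]) fun r hr v => ?_
    simp [homExt_smul _ hr]
  rw [← he] at h
  refine h.homExt_of_affine (μ₁.prod μ₂) ?_ ?_ fun t ht y hy h0 => ?_
  · exact (((continuous_homExt hc1).comp continuous_fst).prodMk continuous_snd).continuousOn
  · refine (hG.comp (f := fun y : E₁ × E₂ => b + ρ • y.1) (by fun_prop) fun y hy => ?_).prodMk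
      (by fun_prop)
    exact add_smul_mem_closedBall b hρ.le (by rw [mem_sphere_zero_iff_norm.1 hy, mul_one])
  · rw [Prod.ext_iff] at h0
    obtain ⟨h1, h2⟩ := h0
    simp only [Prod.fst_add, Prod.smul_fst, Prod.fst_sub, Prod.snd_add, Prod.smul_snd, Prod.snd_sub,
      Prod.fst_zero, Prod.snd_zero] at h1 h2
    have e2 : y.2 + t • ((2 * ρ) • y.2 - y.2) = ((1 - t) + t * (2 * ρ)) • y.2 := by module
    rw [e2, smul_eq_zero] at h2
    -- At a zero on a segment the second component, a positive multiple of `y.2`, forces `y.2 = 0`.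
    -- Then `‖y.1‖ = 1`, where both first components equal `G (b + ρ • y.1) ≠ 0`.
    have hy2 : y.2 = 0 := by
      refine h2.resolve_left (ne_of_gt ?_)
      rcases eq_or_lt_of_le ht.1 with rfl | h0
      · simp
      · have := mul_pos h0 hρ
        linarith [ht.2]
    have hy1 : y.1 ∈ sphere (0 : E₁) 1 := by
      rw [mem_sphere_zero_iff_norm, Prod.norm_def, hy2, norm_zero,
        max_eq_left (norm_nonneg _)] at hy
      exact mem_sphere_zero_iff_norm.2 hy
    have e1 : homExt (fun v => G (b + ρ • v)) y.1 = G (b + ρ • y.1) := by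
      rw [homExt, mem_sphere_zero_iff_norm.1 hy1]
      simp
    rw [e1, sub_self, smul_zero, add_zero] at h1
    exact hGne _ (add_smul_mem_closedBall_diff hρ le_rfl hy1) h1

/-- The linear model: suspension followed by conjugation with `L` and its transpose. It remains to
pass from the image under `L⁻¹` of the sphere of radius `ρ` to the round sphere of radius `r`. -/
theorem HasProperDegree.linear_pullback (L : E ≃L[ℝ] E₁ × E₂) {r : ℝ} (hr : 0 < r)
    (hrL : r * ‖(L : E →L[ℝ] E₁ × E₂)‖ ≤ ρ)
    (hd : HasProperDegree μ₁ (homExt fun v => G (b + ρ • v)) d) :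
    HasProperDegree μ (homExt fun v => pullbackCoeff (L : E →L[ℝ] E₁ × E₂)
      (G (b + (r • L v).1), (2 : ℝ) • (r • L v).2)) d := by
  set H : E₁ × E₂ → E₁ × E₂ := fun y => (G (b + ρ • y.1), (2 * ρ) • y.2) with hH
  have h := (hd.suspension μ₁ Measure.addHaar hρ hG hGne (E₂ := E₂)).linear_conj μ
    (μ₁.prod Measure.addHaar) L (pullbackEquiv L)
  rw [sign_pos (det_pullbackEquiv_pos L)] at h
  simp only [SignType.coe_one, one_mul] at h
  have he : homExt (fun v => pullbackEquiv L (homExt H (L v))) =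
      fun v => pullbackEquiv L (homExt H (L v)) := by
    refine homExt_eq_self (by simp [homExt]) fun r hr v => ?_
    rw [map_smul, homExt_smul _ hr, map_smul]
  rw [← hH, ← he] at h
  have hL0 : ∀ v ∈ sphere (0 : E) 1, L v ≠ 0 := fun v hv h0 => by
    have : v = 0 := L.injective (by rw [h0, map_zero])
    exact ne_zero_of_mem_unit_sphere ⟨v, hv⟩ this
  have hLn : ∀ v ∈ sphere (0 : E) 1, ‖L v‖ ≤ ‖(L : E →L[ℝ] E₁ × E₂)‖ := fun v hv => by
    have := (L : E →L[ℝ] E₁ × E₂).le_opNorm v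
    rwa [mem_sphere_zero_iff_norm.1 hv, mul_one] at this
  -- The scale along the ray through `L v` moves from `ρ / ‖L v‖`, which lands on the sphere of
  -- radius `ρ`, to `r`. It stays positive and within that ball because `r ‖L‖ ≤ ρ`.
  let s : ℝ → E → ℝ := fun t v => (1 - t) * (ρ * ‖L v‖⁻¹) + t * r
  have hs : ∀ t ∈ Icc (0 : ℝ) 1, ∀ v ∈ sphere (0 : E) 1, 0 < s t v ∧ s t v * ‖L v‖ ≤ ρ := by
    intro t ht v hv
    have hLv := norm_pos_iff.2 (hL0 v hv)
    have h1 : r * ‖L v‖ ≤ ρ := (mul_le_mul_of_nonneg_left (hLn v hv) hr.le).trans hrL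
    have h2 : ρ * ‖L v‖⁻¹ * ‖L v‖ = ρ := by field_simp
    constructor
    · have h3 : 0 < ρ * ‖L v‖⁻¹ := by positivity
      rcases eq_or_lt_of_le ht.1 with rfl | h0
      · simpa [s] using h3
      · have := mul_pos h0 hr
        have := mul_nonneg (sub_nonneg.2 ht.2) h3.le
        simp only [s]
        linarith
    · simp only [s]
      rw [add_mul, mul_assoc (1 - t), h2, mul_assoc]
      nlinarith [ht.1]
  have hcont : ContinuousOn (fun p : ℝ × E => pullbackEquiv L
      (G (b + (s p.1 p.2 • L p.2).1), (2 : ℝ) • (s p.1 p.2 • L p.2).2))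
      (Icc (0 : ℝ) 1 ×ˢ sphere 0 1) := by
    have hsc : ContinuousOn (fun p : ℝ × E => s p.1 p.2) (Icc (0 : ℝ) 1 ×ˢ sphere 0 1) := by
      have : ContinuousOn (fun p : ℝ × E => ‖L p.2‖⁻¹) (Icc (0 : ℝ) 1 ×ˢ sphere 0 1) :=
        ContinuousOn.inv₀ (by fun_prop) fun p hp => norm_ne_zero_iff.2 (hL0 p.2 hp.2)
      simp only [s]
      fun_prop
    have hsL : ContinuousOn (fun p : ℝ × E => s p.1 p.2 • L p.2) (Icc (0 : ℝ) 1 ×ˢ sphere 0 1) :=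
      hsc.smul (by fun_prop)
    refine (pullbackEquiv L).continuous.comp_continuousOn (ContinuousOn.prodMk
      (hG.comp (f := fun p : ℝ × E => b + (s p.1 p.2 • L p.2).1) ?_ fun p hp => ?_)
      (continuousOn_const.smul (continuous_snd.comp_continuousOn hsL)))
    · exact continuousOn_const.add (continuous_fst.comp_continuousOn hsL)
    · exact add_smul_mem_closedBall b (hs _ hp.1 _ hp.2).1.le (hs _ hp.1 _ hp.2).2
  have hnz : ∀ t ∈ Icc (0 : ℝ) 1, ∀ v ∈ sphere (0 : E) 1, pullbackEquiv L
      (G (b + (s t v • L v).1), (2 : ℝ) • (s t v • L v).2) ≠ 0 := by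
    intro t ht v hv h0
    rw [map_eq_zero_iff _ (pullbackEquiv L).injective] at h0
    exact suspension_ne_zero hGne (smul_ne_zero (hs t ht v hv).1.ne' (hL0 v hv))
      (add_smul_mem_closedBall b (hs t ht v hv).1.le (hs t ht v hv).2) h0
  have hstart : HasProperDegree μ (homExt fun v => pullbackEquiv L
      (G (b + (s 0 v • L v).1), (2 : ℝ) • (s 0 v • L v).2)) d := by
    have heq : ∀ v, pullbackEquiv L (homExt H (L v)) = ‖L v‖ • pullbackEquiv L
        (G (b + (s 0 v • L v).1), (2 : ℝ) • (s 0 v • L v).2) := by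
      intro v
      rw [← map_smul]
      simp [homExt, hH, s, smul_smul, mul_assoc]
    have hc0 : ContinuousOn (fun v => pullbackEquiv L
        (G (b + (s 0 v • L v).1), (2 : ℝ) • (s 0 v • L v).2)) (sphere 0 1) :=
      hcont.comp (f := fun v : E => ((0 : ℝ), v)) (by fun_prop)
      fun v (hv : v ∈ sphere (0 : E) 1) => ⟨by simp, hv⟩
    refine h.homExt_of_pos_smul μ ?_ hc0 (fun v hv => ?_) fun v hv =>
      ⟨‖L v‖⁻¹, inv_pos.2 (norm_pos_iff.2 (hL0 v hv)), ?_⟩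
    · simp only [heq]
      exact ContinuousOn.smul (by fun_prop) hc0
    · rw [heq]
      exact smul_ne_zero (norm_ne_zero_iff.2 (hL0 v hv)) (hnz 0 (by simp) v hv)
    · rw [heq, smul_smul, inv_mul_cancel₀ (norm_ne_zero_iff.2 (hL0 v hv)), one_smul]
  have := HasProperDegree.homExt_of_homotopy μ (h := fun t v => pullbackEquiv L
      (G (b + (s t v • L v).1), (2 : ℝ) • (s t v • L v).2)) hcont hnz hstart
  simpa [s, pullbackEquiv_apply] using this

end

end Transfer
end

noncomputable section

/-! ### Interpolation between a local diffeomorphism and its linear part. -/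

section Interpolation

variable {E F : Type*} [NormedAddCommGroup E] [NormedSpace ℝ E] [NormedAddCommGroup F]
  [NormedSpace ℝ F]

/-- The affine interpolation between the linear map `L` and `Ψ`, centred at `a`. -/
def interpMap (Ψ : E → F) (L : E →L[ℝ] F) (a : E) (t : ℝ) (u : E) : F :=
  L (u - a) + t • (Ψ u - Ψ a - L (u - a))

/-- The affine interpolation between `L` and the derivative of `Ψ`. -/
def interpDeriv (Ψ : E → F) (L : E →L[ℝ] F) (t : ℝ) (u : E) : E →L[ℝ] F :=
  L + t • (fderiv ℝ Ψ u - L)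

theorem continuousOn_interpMap {Ψ : E → F} (L : E →L[ℝ] F) (a : E) {s : Set ℝ} {K : Set E}
    (hΨ : ∀ u ∈ K, ContDiffAt ℝ 1 Ψ u) :
    ContinuousOn (fun p : ℝ × E => interpMap Ψ L a p.1 p.2) (s ×ˢ K) := by
  have h : ContinuousOn (fun p : ℝ × E => Ψ p.2) (s ×ˢ K) :=
    ContinuousOn.comp (t := K) (fun u hu => (hΨ u hu).continuousAt.continuousWithinAt)
      continuousOn_snd fun p hp => hp.2
  have hL : Continuous fun p : ℝ × E => L (p.2 - a) := by fun_prop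
  exact hL.continuousOn.add (continuousOn_fst.smul ((h.sub continuousOn_const).sub hL.continuousOn))

theorem continuousOn_interpDeriv {Ψ : E → F} (L : E →L[ℝ] F) {s : Set ℝ} {K : Set E}
    (hΨ : ∀ u ∈ K, ContDiffAt ℝ 1 Ψ u) :
    ContinuousOn (fun p : ℝ × E => interpDeriv Ψ L p.1 p.2) (s ×ˢ K) := by
  have h : ContinuousOn (fun p : ℝ × E => fderiv ℝ Ψ p.2) (s ×ˢ K) :=
    ContinuousOn.comp (t := K) (fun u hu => ((hΨ u hu).fderiv_right (m := 0)
      (by simp)).continuousAt.continuousWithinAt) continuousOn_snd fun p hp => hp.2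
  exact continuousOn_const.add (continuousOn_fst.smul (h.sub continuousOn_const))

/-- A single radius on which the deformation to the linear part is harmless: the remainder is small
compared with `L (u - a)`, and the derivatives lie in a ball around `L` consisting of invertible
maps, which is convex. The property `p` is carried along so that the same radius serves it. -/
theorem exists_closedBall_interp [CompleteSpace E] {Ψ : E → F} {a : E} (hΨ : ContDiffAt ℝ 1 Ψ a)
    (L : E ≃L[ℝ] F) (hL : fderiv ℝ Ψ a = L) {ρ : ℝ} (hρ : 0 < ρ) {p : E → Prop}
    (hp : ∀ᶠ u in 𝓝 a, p u) :
    ∃ r > 0, r * ‖(L : E →L[ℝ] F)‖ ≤ ρ ∧ ∀ u ∈ closedBall a r, p u ∧ ContDiffAt ℝ 1 Ψ u ∧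
      ∀ t ∈ Icc (0 : ℝ) 1, ‖interpMap Ψ L a t u‖ ≤ ρ ∧ (u ≠ a → interpMap Ψ L a t u ≠ 0) ∧
        ∃ B : E ≃L[ℝ] F, (B : E →L[ℝ] F) = interpDeriv Ψ L t u := by
  have hd : ∀ᶠ u in 𝓝 a, ContDiffAt ℝ 1 Ψ u := hΨ.eventually (by simp)
  obtain ⟨ε₀, hε₀, hball⟩ := Metric.mem_nhds_iff.1 (ContinuousLinearEquiv.nhds L)
  have hdL : ∀ᶠ u in 𝓝 a, fderiv ℝ Ψ u ∈ ball (L : E →L[ℝ] F) ε₀ :=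
    ((hΨ.fderiv_right (m := 0) (by simp)).continuousAt).eventually_mem
      (by rw [hL]; exact ball_mem_nhds _ hε₀)
  -- Since `‖u - a‖ ≤ C ‖L (u - a)‖`, a remainder of at most `‖u - a‖ / (2C)` cannot cancel `L (u -
  -- a)`. The added `1` keeps `C` positive.
  set C : ℝ := ‖(L.symm : F →L[ℝ] E)‖ + 1 with hC
  have hC1 : 1 ≤ C := by rw [hC]; linarith [norm_nonneg (L.symm : F →L[ℝ] E)]
  have hlo : ∀ᶠ u in 𝓝 a, ‖Ψ u - Ψ a - L (u - a)‖ ≤ 1 / (2 * C) * ‖u - a‖ := by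
    have h1 := (hΨ.differentiableAt (by simp)).hasFDerivAt
    rw [hL] at h1
    exact h1.isLittleO.def (by positivity)
  obtain ⟨r₀, hr₀, hr₀sub⟩ := Metric.nhds_basis_closedBall.mem_iff.1
    (hp.and (hd.and (hdL.and hlo)))
  -- The remainder is at most `‖u - a‖`, as `1 / (2C) ≤ 1`; hence `N` bounds the growth of the
  -- interpolation.
  set N : ℝ := ‖(L : E →L[ℝ] F)‖ + 1 with hN
  have hN0 : 0 < N := by positivity
  have hr0 : 0 < min r₀ (ρ / N) := lt_min hr₀ (by positivity)
  have hrN : min r₀ (ρ / N) * N ≤ ρ := (le_div_iff₀ hN0).1 (min_le_right _ _)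
  refine ⟨min r₀ (ρ / N), hr0, (mul_le_mul_of_nonneg_left (by rw [hN]; linarith) hr0.le).trans hrN,
    fun u hu => ?_⟩
  obtain ⟨h1, h2, h3, h4⟩ := hr₀sub (closedBall_subset_closedBall (min_le_left _ _) hu)
  refine ⟨h1, h2, fun t ht => ?_⟩
  have hrem : ‖t • (Ψ u - Ψ a - L (u - a))‖ ≤ 1 / (2 * C) * ‖u - a‖ := by
    rw [norm_smul, Real.norm_of_nonneg ht.1]
    exact (mul_le_of_le_one_left (norm_nonneg _) ht.2).trans h4
  refine ⟨?_, fun hua h0 => ?_, ?_⟩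
  · have h5 : 1 / (2 * C) ≤ 1 := by
      rw [div_le_one (by linarith)]; linarith
    have h6 : ‖u - a‖ ≤ min r₀ (ρ / N) := by rwa [← dist_eq_norm]
    calc ‖interpMap Ψ L a t u‖ ≤ _ := (norm_add_le _ _).trans
          (add_le_add ((L : E →L[ℝ] F).le_opNorm (u - a)) hrem)
      _ ≤ ‖(L : E →L[ℝ] F)‖ * ‖u - a‖ + 1 * ‖u - a‖ := by gcongr
      _ = ‖u - a‖ * N := by rw [hN]; ring
      _ ≤ min r₀ (ρ / N) * N := by gcongr
      _ ≤ ρ := hrN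
  · have h5 : ‖L (u - a)‖ ≤ 1 / (2 * C) * ‖u - a‖ := by
      have h6 := eq_neg_of_add_eq_zero_left h0
      rw [ContinuousLinearEquiv.coe_coe] at h6
      rw [h6, norm_neg]
      exact hrem
    have h6 := (L.symm : F →L[ℝ] E).le_opNorm (L (u - a))
    rw [ContinuousLinearEquiv.coe_coe, ContinuousLinearEquiv.symm_apply_apply] at h6
    have h7 : 0 < ‖u - a‖ := norm_pos_iff.2 (sub_ne_zero.2 hua)
    have h8 : ‖u - a‖ ≤ C * (1 / (2 * C) * ‖u - a‖) :=
      h6.trans (mul_le_mul (by rw [hC]; linarith) h5 (norm_nonneg _) (by linarith))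
    have h9 : C * (1 / (2 * C) * ‖u - a‖) = ‖u - a‖ / 2 := by field_simp
    linarith
  · exact hball ((convex_ball (L : E →L[ℝ] F) ε₀).add_smul_sub_mem (mem_ball_self hε₀) h3 ht)

end Interpolation

/-! ### Degree of a 1-form pulled back from a suspension. -/

section NonlinearTransfer

theorem hasProperDegree_homExt_of_subsingleton {E₁ : Type*} [NormedAddCommGroup E₁]
    [NormedSpace ℝ E₁] [MeasurableSpace E₁] [Subsingleton E₁] (μ₁ : Measure E₁) (h : E₁ → E₁) :
    HasProperDegree μ₁ (homExt h) 1 := by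
  rw [Subsingleton.elim (homExt h) fun v => v]
  exact HasProperDegree.id μ₁

variable {E : Type*} [NormedAddCommGroup E] [InnerProductSpace ℝ E] [CompleteSpace E]
  [FiniteDimensional ℝ E] [MeasurableSpace E] [BorelSpace E]
  {E₁ : Type*} [NormedAddCommGroup E₁] [InnerProductSpace ℝ E₁] [FiniteDimensional ℝ E₁]
  [MeasurableSpace E₁] [BorelSpace E₁]
  {E₂ : Type*} [NormedAddCommGroup E₂] [InnerProductSpace ℝ E₂] [FiniteDimensional ℝ E₂]
  [MeasurableSpace E₂] [BorelSpace E₂]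

/-- The map and its derivative are interpolated to `L` simultaneously. A zero of `Q t` would, by
invertibility of the transposed derivative, be a zero of the suspended field, and that happens only
at `a`. The case `t = 0` is the linear model. -/
theorem exists_hasProperDegree_pullback (μ : Measure E) [μ.IsAddHaarMeasure] (μ₁ : Measure E₁)
    [μ₁.IsAddHaarMeasure] {G : E₁ → E₁} {b : E₁} {ρ : ℝ} (hρ : 0 < ρ)
    (hG : ContinuousOn G (closedBall b ρ)) (hGne : ∀ y ∈ closedBall b ρ \ {b}, G y ≠ 0)
    {Ψ : E → E₁ × E₂} {a : E} (hΨ : ContDiffAt ℝ 1 Ψ a) (L : E ≃L[ℝ] E₁ × E₂)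
    (hL : fderiv ℝ Ψ a = L) (hΨa : Ψ a = (b, 0)) {F : E → E}
    (hF : ∀ᶠ u in 𝓝 a, F u = pullbackCoeff (fderiv ℝ Ψ u) (G (Ψ u).1, (2 : ℝ) • (Ψ u).2)) :
    ∃ r > 0, ContinuousOn F (closedBall a r) ∧ (∀ u ∈ closedBall a r \ {a}, F u ≠ 0) ∧
      ∀ d, HasProperDegree μ₁ (homExt fun v => G (b + ρ • v)) d →
        HasProperDegree μ (homExt fun v => F (a + r • v)) d := by
  obtain ⟨r, hr0, hrL, hsub⟩ := exists_closedBall_interp hΨ L hL hρ hF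
  let P : ℝ → E → E₁ × E₂ := interpMap Ψ L a
  let A : ℝ → E → E →L[ℝ] E₁ × E₂ := interpDeriv Ψ L
  let Q : ℝ → E → E := fun t u => pullbackCoeff (A t u) (G (b + (P t u).1), (2 : ℝ) • (P t u).2)
  have hPb : ∀ t ∈ Icc (0 : ℝ) 1, ∀ u ∈ closedBall a r, b + (P t u).1 ∈ closedBall b ρ := by
    intro t ht u hu
    have h4 := add_smul_mem_closedBall b (ρ := ρ) (y := P t u) zero_le_one
      (by rw [one_mul]; exact ((hsub u hu).2.2 t ht).1)
    rwa [one_smul] at h4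
  have hQ0 : ∀ t ∈ Icc (0 : ℝ) 1, ∀ u ∈ closedBall a r \ {a}, Q t u ≠ 0 := by
    intro t ht u hu
    obtain ⟨-, hP0, B, hB⟩ := (hsub u hu.1).2.2 t ht
    have h := pullbackCoeff_ne_zero B (suspension_ne_zero hGne (hP0 hu.2) (hPb t ht u hu.1))
    rw [hB] at h
    exact h
  have hQc : ContinuousOn (fun p : ℝ × E => Q p.1 p.2) (Icc (0 : ℝ) 1 ×ˢ closedBall a r) := by
    have c3 : ContinuousOn (fun p : ℝ × E => P p.1 p.2) (Icc (0 : ℝ) 1 ×ˢ closedBall a r) :=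
      continuousOn_interpMap _ a fun u hu => (hsub u hu).2.1
    have c4 : ContinuousOn (fun p : ℝ × E => A p.1 p.2) (Icc (0 : ℝ) 1 ×ˢ closedBall a r) :=
      continuousOn_interpDeriv _ fun u hu => (hsub u hu).2.1
    have c5 : ContinuousOn (fun p : ℝ × E => b + (P p.1 p.2).1) (Icc (0 : ℝ) 1 ×ˢ closedBall a r) :=
      continuousOn_const.add c3.fst
    have c6 : ContinuousOn (fun p : ℝ × E => G (b + (P p.1 p.2).1))
        (Icc (0 : ℝ) 1 ×ˢ closedBall a r) :=
      hG.comp c5 fun p hp => hPb _ hp.1 _ hp.2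
    exact c4.pullbackCoeff (c6.prodMk (c3.snd.const_smul (2 : ℝ)))
  have hQ1c : ContinuousOn (Q 1) (closedBall a r) :=
    hQc.comp (f := fun u => ((1 : ℝ), u)) (by fun_prop) fun u hu => ⟨by simp, hu⟩
  have hQ1 : ∀ u ∈ closedBall a r, F u = Q 1 u := by
    intro u hu
    have e : P 1 u = Ψ u - (b, 0) := by simp [P, interpMap, hΨa]
    have e' : A 1 u = fderiv ℝ Ψ u := by simp [A, interpDeriv]
    simp only [(hsub u hu).1, Q, e, e', Prod.fst_sub, Prod.snd_sub, add_sub_cancel, sub_zero]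
  have hmem : ∀ v ∈ sphere (0 : E) 1, a + r • v ∈ closedBall a r \ {a} := fun v hv =>
    add_smul_mem_closedBall_diff hr0 le_rfl hv
  refine ⟨r, hr0, hQ1c.congr hQ1, fun u hu => ?_, fun d hd => ?_⟩
  · rw [hQ1 u hu.1]
    exact hQ0 1 (by simp) u hu
  · have hQr : ContinuousOn (fun p : ℝ × E => Q p.1 (a + r • p.2)) (Icc (0 : ℝ) 1 ×ˢ sphere 0 1) :=
      hQc.comp (f := fun p : ℝ × E => (p.1, a + r • p.2)) (by fun_prop)
        fun p hp => ⟨hp.1, (hmem _ hp.2).1⟩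
    have h0 : HasProperDegree μ (homExt fun v => Q 0 (a + r • v)) d := by
      have e : ∀ v, P 0 (a + r • v) = r • L v := fun v => by
        simp only [P, interpMap, zero_smul, add_zero, add_sub_cancel_left,
          ContinuousLinearEquiv.coe_coe, map_smul]
      have e' : ∀ v, A 0 (a + r • v) = L := fun v => by simp [A, interpDeriv]
      simp only [Q, e, e']
      exact hd.linear_pullback μ μ₁ hρ hG hGne L hr0 hrL
    have h1 := HasProperDegree.homExt_of_homotopy μ (h := fun t v => Q t (a + r • v)) (d := d)
      hQr (fun t ht v hv => hQ0 t ht _ (hmem v hv)) h0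
    have hQ1r : ContinuousOn (fun v => Q 1 (a + r • v)) (sphere 0 1) :=
      hQ1c.comp (f := fun v : E => a + r • v) (by fun_prop) fun v hv => (hmem v hv).1
    exact h1.homExt_of_pos_smul μ hQ1r (hQ1r.congr fun v hv => hQ1 _ (hmem v hv).1)
      (fun v hv => hQ0 1 (by simp) _ (hmem v hv))
      fun v hv => ⟨1, one_pos, by rw [one_smul, hQ1 _ (hmem v hv).1]⟩

end NonlinearTransfer
end

noncomputable section

/-! ### Coefficients of 1-forms in charts -/

section Chart

variable {𝕜 : Type*} [NontriviallyNormedField 𝕜] {E : Type*} [NormedAddCommGroup E]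
  [NormedSpace 𝕜 E] {M : Type*} [TopologicalSpace M] [ChartedSpace E M]

theorem mdifferentiableAt_chartAt_symm [IsManifold 𝓘(𝕜, E) 1 M] (x : M) {u : E}
    (hu : u ∈ (chartAt E x).target) :
    MDifferentiableAt 𝓘(𝕜, E) 𝓘(𝕜, E) (chartAt E x).symm u :=
  ((contMDiffOn_chart_symm (I := 𝓘(𝕜, E)) (n := 1) (x := x)).contMDiffAt
    ((chartAt E x).open_target.mem_nhds hu)).mdifferentiableAt one_ne_zero

theorem mdifferentiableAt_chartAt [IsManifold 𝓘(𝕜, E) 1 M] (x : M) {q : M}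
    (hq : q ∈ (chartAt E x).source) :
    MDifferentiableAt 𝓘(𝕜, E) 𝓘(𝕜, E) (chartAt E x) q :=
  ((contMDiffOn_chart (I := 𝓘(𝕜, E)) (n := 1) (x := x)).contMDiffAt
    ((chartAt E x).open_source.mem_nhds hq)).mdifferentiableAt one_ne_zero

/-- The derivative of the chart is a right inverse, by the chain rule; hence a form whose
coefficients vanish at a point is zero there. -/
theorem mfderiv_chartAt_symm_surjective [IsManifold 𝓘(𝕜, E) 1 M] (x : M) {u : E}
    (hu : u ∈ (chartAt E x).target) :
    Function.Surjective (mfderiv 𝓘(𝕜, E) 𝓘(𝕜, E) (chartAt E x).symm u) := by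
  have hs : (chartAt E x).symm u ∈ (chartAt E x).source := (chartAt E x).map_target hu
  have h1 : MDifferentiableAt 𝓘(𝕜, E) 𝓘(𝕜, E) (chartAt E x) ((chartAt E x).symm u) :=
    mdifferentiableAt_chartAt x hs
  have hr : chartAt E x ((chartAt E x).symm u) = u := (chartAt E x).right_inv hu
  have h2 : MDifferentiableAt 𝓘(𝕜, E) 𝓘(𝕜, E) (chartAt E x).symm
      (chartAt E x ((chartAt E x).symm u)) := by
    rw [hr]; exact mdifferentiableAt_chartAt_symm x hu
  have h3 := mfderiv_comp ((chartAt E x).symm u) h2 h1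
  have h4 : mfderiv 𝓘(𝕜, E) 𝓘(𝕜, E) ((chartAt E x).symm ∘ chartAt E x) ((chartAt E x).symm u) =
      mfderiv 𝓘(𝕜, E) 𝓘(𝕜, E) (id : M → M) ((chartAt E x).symm u) :=
    Filter.EventuallyEq.mfderiv_eq
      (eventually_of_mem ((chartAt E x).open_source.mem_nhds hs) fun q hq =>
        (chartAt E x).left_inv hq)
  rw [mfderiv_id] at h4
  intro v
  rw [h4] at h3
  refine ⟨mfderiv 𝓘(𝕜, E) 𝓘(𝕜, E) (chartAt E x) ((chartAt E x).symm u) v, ?_⟩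
  have h5 := congrArg (fun T => T v) h3
  -- The base points agree only propositionally and tangent spaces depend on them; quantifying over
  -- `u'` lets the equality be substituted.
  have h6 : ∀ u' : E, u' = u → ∀ w : E,
      (mfderiv 𝓘(𝕜, E) 𝓘(𝕜, E) (chartAt E x).symm u' w : E) =
        mfderiv 𝓘(𝕜, E) 𝓘(𝕜, E) (chartAt E x).symm u w := by
    rintro _ rfl w; rfl
  exact (h6 _ hr _).symm.trans h5.symm

/-- The trivialization of the cotangent bundle centred at `x` is composition with the derivative of
the inverse chart, so continuity of the section is continuity of its expression in the chart. -/
theorem continuousOn_chart_pullback [IsManifold 𝓘(𝕜, E) 1 M]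
    {η : ∀ x : M, TangentSpace 𝓘(𝕜, E) x →L[𝕜] 𝕜}
    (hη : Continuous fun x : M => Bundle.TotalSpace.mk' (E →L[𝕜] 𝕜)
      (E := fun x : M => TangentSpace 𝓘(𝕜, E) x →L[𝕜] 𝕜) x (η x)) (x : M) :
    ContinuousOn (fun u : E => ((η ((chartAt E x).symm u)).comp
      (mfderiv 𝓘(𝕜, E) 𝓘(𝕜, E) (chartAt E x).symm u) : E →L[𝕜] 𝕜)) (chartAt E x).target := by
  let T := trivializationAt (E →L[𝕜] 𝕜) (fun x : M => TangentSpace 𝓘(𝕜, E) x →L[𝕜] 𝕜) x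
  have hT : ContinuousOn T T.source := T.continuousOn
  have h1 : ContinuousOn (fun u => T (Bundle.TotalSpace.mk' (E →L[𝕜] 𝕜)
      (E := fun x : M => TangentSpace 𝓘(𝕜, E) x →L[𝕜] 𝕜) _ (η ((chartAt E x).symm u))))
      (chartAt E x).target := by
    refine hT.comp (hη.comp_continuousOn (chartAt E x).continuousOn_symm) fun u hu => ?_
    refine ⟨?_, mem_univ _⟩
    simpa using (chartAt E x).map_target hu
  refine (continuous_snd.comp_continuousOn h1).congr fun u hu => ?_
  have hs : (chartAt E x).symm u ∈ (chartAt E x).source := (chartAt E x).map_target hu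
  have h2 := TangentBundle.symmL_trivializationAt (I := 𝓘(𝕜, E)) hs
  ext v
  simp only [Function.comp, T, hom_trivializationAt_apply, ContinuousLinearMap.inCoordinates]
  rw [h2]
  simp [mfderivWithin_univ]
  have h6 : ∀ u' : E, u' = u →
      (mfderiv 𝓘(𝕜, E) 𝓘(𝕜, E) (chartAt E x).symm u' v : E) =
        mfderiv 𝓘(𝕜, E) 𝓘(𝕜, E) (chartAt E x).symm u v := by
    rintro _ rfl; rfl
  exact congrArg (η ((chartAt E x).symm u)) (h6 _ ((chartAt E x).right_inv hu)).symm

end Chart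

/-! ### Coefficients and isolated zeros of real forms. -/

section RealCoeff

variable {n : ℕ} {M : Type*} [TopologicalSpace M] [ChartedSpace (Cn n) M]

theorem RealForm.inner_coeff (η : RealForm n M) (x : M) (u w : Cn n) :
    inner ℝ (η.coeff x u) w = η ((chartAt (Cn n) x).symm u)
      (mfderiv 𝓘(ℝ, Cn n) 𝓘(ℝ, Cn n) (chartAt (Cn n) x).symm u w) := by
  rw [RealForm.coeff, InnerProductSpace.toDual_symm_apply]
  rfl

variable [IsManifold 𝓘(ℂ, Cn n) ω M]

instance realManifold_one : IsManifold 𝓘(ℝ, Cn n) 1 M :=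
  IsManifold.of_le (n := ∞) (by exact_mod_cast le_top)

theorem RealForm.IsContinuous.continuousOn_coeff {η : RealForm n M} (hη : η.IsContinuous) (x : M) :
    ContinuousOn (η.coeff x) (chartAt (Cn n) x).target :=
  (InnerProductSpace.toDual ℝ (Cn n)).symm.continuous.comp_continuousOn
    (continuousOn_chart_pullback hη x)

theorem RealForm.coeff_eq_zero_iff (η : RealForm n M) (x : M) {u : Cn n}
    (hu : u ∈ (chartAt (Cn n) x).target) :
    η.coeff x u = 0 ↔ η ((chartAt (Cn n) x).symm u) = 0 := by
  constructor
  · intro h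
    ext v
    obtain ⟨w, rfl⟩ := mfderiv_chartAt_symm_surjective (𝕜 := ℝ) x hu v
    have hw := η.inner_coeff x u w
    rw [h] at hw
    exact hw.symm.trans (inner_zero_left (𝕜 := ℝ) (show Cn n from w))
  · intro h
    refine ext_inner_right ℝ fun w => ?_
    rw [η.inner_coeff x u w, h, inner_zero_left]
    rfl

/-- In the preferred chart at an isolated singularity, a form has no other zero on a small closed
ball. -/
theorem RealForm.IsIsolatedSingularity.exists_closedBall {η : RealForm n M} {x : M}
    (h : η.IsIsolatedSingularity x) :
    ∃ r > 0, closedBall (chartAt (Cn n) x x) r ⊆ (chartAt (Cn n) x).target ∧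
      ∀ u ∈ closedBall (chartAt (Cn n) x x) r \ {chartAt (Cn n) x x}, η.coeff x u ≠ 0 := by
  have hx := mem_chart_source (Cn n) x
  have ht := mem_chart_target (Cn n) x
  have hc : Tendsto (chartAt (Cn n) x).symm (𝓝 (chartAt (Cn n) x x)) (𝓝 x) := by
    have := (chartAt (Cn n) x).continuousAt_symm ht
    rwa [ContinuousAt, (chartAt (Cn n) x).left_inv hx] at this
  have h1 := hc.eventually (eventually_nhdsWithin_iff.1 h.2)
  obtain ⟨r, hr, hsub⟩ := Metric.nhds_basis_closedBall.mem_iff.1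
    (h1.and ((chartAt (Cn n) x).open_target.mem_nhds ht))
  refine ⟨r, hr, fun u hu => (hsub hu).2, fun u hu h0 => ?_⟩
  refine (hsub hu.1).1 (fun hux => hu.2 ?_) ((η.coeff_eq_zero_iff x (hsub hu.1).2).1 h0)
  rw [mem_singleton_iff, ← (chartAt (Cn n) x).right_inv (hsub hu.1).2, mem_singleton_iff.1 hux]

theorem RealForm.isIsolatedSingularity_of_coeff {η : RealForm n M} {q : M} (h : η q = 0) {r : ℝ} (hr : 0 < r)
    (hne : ∀ u ∈ closedBall (chartAt (Cn n) q q) r \ {chartAt (Cn n) q q}, η.coeff q u ≠ 0) :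
    η.IsIsolatedSingularity q := by
  refine ⟨h, eventually_nhdsWithin_iff.2 ?_⟩
  have hs := (chartAt (Cn n) q).open_source.mem_nhds (mem_chart_source _ q)
  filter_upwards [hs, (chartAt (Cn n) q).continuousAt (mem_chart_source _ q)
    (closedBall_mem_nhds _ hr)] with z hz hz' hzq h0
  refine hne _ ⟨hz', fun h1 => hzq ((chartAt (Cn n) q).injOn hz (mem_chart_source _ q) h1)⟩ ?_
  rw [η.coeff_eq_zero_iff q ((chartAt (Cn n) q).map_source hz), (chartAt (Cn n) q).left_inv hz, h0]

end RealCoeff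
end

noncomputable section

/-! ### The radial extension in charts -/

namespace ProductNhd

variable {m s k : ℕ} {M : Type*} [TopologicalSpace M] [ChartedSpace (Cn m) M]
  {S : Type*} [TopologicalSpace S] [ChartedSpace (Cn s) S]
  {ι : S → M} {x : S} (N : ProductNhd (m := m) (s := s) ι x k)

theorem mem_source : ι x ∈ N.diffeo.source :=
  (N.source_inter.symm ▸ mem_image_of_mem ι N.mem_base : ι x ∈ N.diffeo.source ∩ range ι).1

theorem toBase_eq : N.toBase (ι x) = x := by
  rw [toBase, N.map_base x N.mem_base]

theorem toDisc_eq : N.toDisc (ι x) = 0 := by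
  rw [toDisc, N.map_base x N.mem_base]

theorem contMDiffAt_toBase {q : M} (hq : q ∈ N.diffeo.source) :
    ContMDiffAt 𝓘(ℝ, Cn m) 𝓘(ℝ, Cn s) ∞ N.toBase q :=
  (N.diffeo.contMDiffOn.contMDiffAt (N.diffeo.open_source.mem_nhds hq)).fst

theorem contMDiffAt_toDisc {q : M} (hq : q ∈ N.diffeo.source) :
    ContMDiffAt 𝓘(ℝ, Cn m) 𝓘(ℝ, EuclideanSpace ℝ (Fin k)) ∞ N.toDisc q :=
  (N.diffeo.contMDiffOn.contMDiffAt (N.diffeo.open_source.mem_nhds hq)).snd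

theorem map_mem_target : (x, (0 : EuclideanSpace ℝ (Fin k))) ∈ N.diffeo.target := by
  rw [← N.map_base x N.mem_base]; exact N.diffeo.map_source N.mem_source

theorem symm_map : N.diffeo.symm (x, 0) = ι x := by
  rw [← N.map_base x N.mem_base]; exact N.diffeo.left_inv N.mem_source

theorem radialExtension_apply_eq_zero {η : RealForm s S} (h : η x = 0) :
    N.radialExtension η (ι x) = 0 := by
  have h1 : ∀ y : S, y = x → ∀ v : Cn s, η y v = 0 := by
    rintro _ rfl v
    rw [h]
    rfl
  have h2 : ∀ y : EuclideanSpace ℝ (Fin k), y = 0 → ∀ v : EuclideanSpace ℝ (Fin k),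
      mfderiv 𝓘(ℝ, EuclideanSpace ℝ (Fin k)) 𝓘(ℝ, ℝ)
        (fun y : EuclideanSpace ℝ (Fin k) => ‖y‖ ^ 2) y v = (0 : ℝ) := by
    rintro _ rfl v
    rw [mfderiv_eq_fderiv, (hasStrictFDerivAt_norm_sq _).hasFDerivAt.fderiv]
    simp
    rfl
  ext v
  exact (congrArg₂ (fun a b : ℝ => a + b) (h1 _ N.toBase_eq _) (h2 _ N.toDisc_eq _)).trans (add_zero 0)

/-- The projections `(π, p)` in the preferred charts at `ι x` and `x`. -/
def chartMap (u : Cn m) : Cn s × EuclideanSpace ℝ (Fin k) :=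
  (chartAt (Cn s) x (N.toBase ((chartAt (Cn m) (ι x)).symm u)),
    N.toDisc ((chartAt (Cn m) (ι x)).symm u))

/-- The inverse of `chartMap`. -/
def chartMapInv (y : Cn s × EuclideanSpace ℝ (Fin k)) : Cn m :=
  chartAt (Cn m) (ι x) (N.diffeo.symm ((chartAt (Cn s) x).symm y.1, y.2))

theorem chartMap_apply : N.chartMap (chartAt (Cn m) (ι x) (ι x)) = (chartAt (Cn s) x x, 0) := by
  rw [chartMap, (chartAt (Cn m) (ι x)).left_inv (mem_chart_source _ _), N.toBase_eq, N.toDisc_eq]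

theorem eventually_mem : ∀ᶠ u in 𝓝 (chartAt (Cn m) (ι x) (ι x)),
    u ∈ (chartAt (Cn m) (ι x)).target ∧ (chartAt (Cn m) (ι x)).symm u ∈ N.diffeo.source ∧
      N.toBase ((chartAt (Cn m) (ι x)).symm u) ∈ (chartAt (Cn s) x).source := by
  have ht := mem_chart_target (Cn m) (ι x)
  have hl := (chartAt (Cn m) (ι x)).left_inv (mem_chart_source (Cn m) (ι x))
  have h1 : (chartAt (Cn m) (ι x)).target ∈ 𝓝 (chartAt (Cn m) (ι x) (ι x)) :=
    (chartAt (Cn m) (ι x)).open_target.mem_nhds ht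
  have hc : Tendsto (chartAt (Cn m) (ι x)).symm (𝓝 (chartAt (Cn m) (ι x) (ι x))) (𝓝 (ι x)) := by
    have := (chartAt (Cn m) (ι x)).continuousAt_symm ht
    rwa [ContinuousAt, hl] at this
  have h2 := (N.contMDiffAt_toBase N.mem_source).continuousAt
  rw [ContinuousAt, N.toBase_eq] at h2
  exact Filter.Eventually.and h1 (Filter.Eventually.and
    (hc (N.diffeo.open_source.mem_nhds N.mem_source)) ((h2.comp hc) ((chartAt (Cn s) x).open_source.mem_nhds (mem_chart_source _ x))))

theorem symm_chart_apply :
    N.diffeo.symm ((chartAt (Cn s) x).symm (chartAt (Cn s) x x), 0) = ι x := by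
  rw [(chartAt (Cn s) x).left_inv (mem_chart_source (Cn s) x)]
  exact N.symm_map

variable [IsManifold 𝓘(ℂ, Cn s) ω S]

theorem contMDiffAt_symm_comp_chart :
    ContMDiffAt 𝓘(ℝ, Cn s × EuclideanSpace ℝ (Fin k))
      (𝓘(ℝ, Cn s).prod 𝓘(ℝ, EuclideanSpace ℝ (Fin k))) ∞
      (fun y : Cn s × EuclideanSpace ℝ (Fin k) => ((chartAt (Cn s) x).symm y.1, y.2))
      (chartAt (Cn s) x x, 0) :=
  ContMDiffAt.prodMk
    ((contMDiffOn_chart_symm.contMDiffAt ((chartAt (Cn s) x).open_target.mem_nhds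
      (mem_chart_target (Cn s) x))).comp_of_eq contDiff_fst.contMDiff.contMDiffAt rfl)
    contDiff_snd.contMDiff.contMDiffAt

theorem contMDiffAt_symm_chart :
    ContMDiffAt 𝓘(ℝ, Cn s × EuclideanSpace ℝ (Fin k)) 𝓘(ℝ, Cn m) ∞
      (fun y : Cn s × EuclideanSpace ℝ (Fin k) =>
        N.diffeo.symm ((chartAt (Cn s) x).symm y.1, y.2)) (chartAt (Cn s) x x, 0) :=
  (N.diffeo.symm.contMDiffOn.contMDiffAt
    (N.diffeo.symm.open_source.mem_nhds N.map_mem_target)).comp_of_eq contMDiffAt_symm_comp_chart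
    (by rw [(chartAt (Cn s) x).left_inv (mem_chart_source (Cn s) x)])

theorem chartMap_comp_chartMapInv :
    N.chartMap ∘ N.chartMapInv =ᶠ[𝓝 (chartAt (Cn s) x x, 0)] id := by
  have h1 : ∀ᶠ y : Cn s × EuclideanSpace ℝ (Fin k) in 𝓝 (chartAt (Cn s) x x, 0),
      y.1 ∈ (chartAt (Cn s) x).target :=
    continuousAt_fst ((chartAt (Cn s) x).open_target.mem_nhds (mem_chart_target (Cn s) x))
  have c2 := (contMDiffAt_symm_comp_chart (s := s) (k := k) (x := x)).continuousAt
  have h2 := c2 (N.diffeo.open_target.mem_nhds (by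
    simp only [(chartAt (Cn s) x).left_inv (mem_chart_source (Cn s) x)]; exact N.map_mem_target))
  have h3 := N.contMDiffAt_symm_chart.continuousAt ((chartAt (Cn m) (ι x)).open_source.mem_nhds (by
    rw [N.symm_chart_apply]; exact mem_chart_source _ _))
  filter_upwards [h1, h2, h3] with y h1 h2 h3
  have e : N.diffeo (N.diffeo.symm ((chartAt (Cn s) x).symm y.1, y.2)) =
    ((chartAt (Cn s) x).symm y.1, y.2) := N.diffeo.right_inv h2
  simp only [Function.comp, chartMap, chartMapInv, (chartAt (Cn m) (ι x)).left_inv h3, toBase,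
    toDisc, e, (chartAt (Cn s) x).right_inv h1, id]

variable [IsManifold 𝓘(ℂ, Cn m) ω M]

theorem contDiffAt_chartMap : ContDiffAt ℝ ∞ N.chartMap (chartAt (Cn m) (ι x) (ι x)) := by
  have ht := mem_chart_target (Cn m) (ι x)
  have hl := (chartAt (Cn m) (ι x)).left_inv (mem_chart_source (Cn m) (ι x))
  have h0 : ContMDiffAt 𝓘(ℝ, Cn m) 𝓘(ℝ, Cn m) ∞ (chartAt (Cn m) (ι x)).symm
      (chartAt (Cn m) (ι x) (ι x)) :=
    contMDiffOn_chart_symm.contMDiffAt ((chartAt (Cn m) (ι x)).open_target.mem_nhds ht)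
  have h1 : ContMDiffAt 𝓘(ℝ, Cn s) 𝓘(ℝ, Cn s) ∞ (chartAt (Cn s) x) x :=
    contMDiffOn_chart.contMDiffAt ((chartAt (Cn s) x).open_source.mem_nhds (mem_chart_source _ x))
  have h2 := (N.contMDiffAt_toBase N.mem_source).comp_of_eq h0 hl
  have h3 := (N.contMDiffAt_toDisc N.mem_source).comp_of_eq h0 hl
  have h4 := h1.comp_of_eq h2 (by rw [Function.comp, hl, N.toBase_eq])
  exact h4.contDiffAt.prodMk h3.contDiffAt

theorem contDiffAt_chartMapInv : ContDiffAt ℝ ∞ N.chartMapInv (chartAt (Cn s) x x, 0) :=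
  (ContMDiffAt.comp_of_eq
    (contMDiffOn_chart.contMDiffAt
      ((chartAt (Cn m) (ι x)).open_source.mem_nhds (mem_chart_source _ _)))
    N.contMDiffAt_symm_chart N.symm_chart_apply).contDiffAt

/-- The chain rule applied to both composites of `chartMap` with its local inverse shows that the
two derivatives are mutually inverse. -/
theorem exists_fderiv_chartMap_eq : ∃ L : Cn m ≃L[ℝ] Cn s × EuclideanSpace ℝ (Fin k),
    fderiv ℝ N.chartMap (chartAt (Cn m) (ι x) (ι x)) = L := by
  set a := chartAt (Cn m) (ι x) (ι x)
  have ha := N.chartMap_apply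
  have hd : DifferentiableAt ℝ N.chartMap a := N.contDiffAt_chartMap.differentiableAt (by simp)
  have hi : DifferentiableAt ℝ N.chartMapInv (N.chartMap a) := by
    rw [ha]; exact N.contDiffAt_chartMapInv.differentiableAt (by simp)
  have e1 : N.chartMapInv ∘ N.chartMap =ᶠ[𝓝 a] id := by
    filter_upwards [N.eventually_mem] with u ⟨h1, h2, h3⟩
    simp only [Function.comp, chartMap, chartMapInv, (chartAt (Cn s) x).left_inv h3]
    exact (congrArg _ (N.diffeo.left_inv h2)).trans ((chartAt (Cn m) (ι x)).right_inv h1)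
  have hia : N.chartMapInv (N.chartMap a) = a := e1.self_of_nhds
  have e2 : N.chartMap ∘ N.chartMapInv =ᶠ[𝓝 (N.chartMap a)] id := by
    rw [ha]; exact N.chartMap_comp_chartMapInv
  have hd' : DifferentiableAt ℝ N.chartMap (N.chartMapInv (N.chartMap a)) := by rwa [hia]
  have f1 := (hi.hasFDerivAt.comp a hd.hasFDerivAt).congr_of_eventuallyEq e1.symm
  have f2 := (hd'.hasFDerivAt.comp _ hi.hasFDerivAt).congr_of_eventuallyEq e2.symm
  rw [hia] at f2
  have g1 := f1.unique (hasFDerivAt_id a)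
  have g2 := f2.unique (hasFDerivAt_id _)
  exact ⟨ContinuousLinearEquiv.equivOfInverse (fderiv ℝ N.chartMap a)
    (fderiv ℝ N.chartMapInv (N.chartMap a)) (fun v => congrArg (fun T => T v) g1)
    (fun v => congrArg (fun T => T v) g2), rfl⟩

theorem parallelExtension_apply {u w : Cn m} (hu : u ∈ (chartAt (Cn m) (ι x)).target)
    (hD : (chartAt (Cn m) (ι x)).symm u ∈ N.diffeo.source)
    (hS : N.toBase ((chartAt (Cn m) (ι x)).symm u) ∈ (chartAt (Cn s) x).source)
    (hd : DifferentiableAt ℝ N.chartMap u) (η : RealForm s S) :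
    N.parallelExtension η ((chartAt (Cn m) (ι x)).symm u)
        (mfderiv 𝓘(ℝ, Cn m) 𝓘(ℝ, Cn m) (chartAt (Cn m) (ι x)).symm u w) =
      inner ℝ (η.coeff x (N.chartMap u).1) (fderiv ℝ N.chartMap u w).1 := by
  have he := mdifferentiableAt_chartAt_symm (𝕜 := ℝ) (ι x) hu
  have hB := (N.contMDiffAt_toBase hD).mdifferentiableAt (by simp)
  have hc := mfderiv_comp_apply u hB he w
  have hd1 : MDifferentiableAt 𝓘(ℝ, Cn m) 𝓘(ℝ, Cn s) (fun u => (N.chartMap u).1) u :=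
    hd.fst.mdifferentiableAt
  have ht : (N.chartMap u).1 ∈ (chartAt (Cn s) x).target := (chartAt (Cn s) x).map_source hS
  have hc' := mfderiv_comp_apply u (mdifferentiableAt_chartAt_symm (𝕜 := ℝ) x ht) hd1 w
  have h1 : mfderiv 𝓘(ℝ, Cn m) 𝓘(ℝ, Cn s) (fun u => (N.chartMap u).1) u w =
      (fderiv ℝ N.chartMap u w).1 := by
    rw [mfderiv_eq_fderiv, fderiv.fst hd]; rfl
  have hev : N.toBase ∘ (chartAt (Cn m) (ι x)).symm =ᶠ[𝓝 u]
      (chartAt (Cn s) x).symm ∘ fun u => (N.chartMap u).1 := by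
    filter_upwards [(hB.comp u he).continuousAt ((chartAt (Cn s) x).open_source.mem_nhds hS)]
      with v hv
    exact ((chartAt (Cn s) x).left_inv hv).symm
  have key : ∀ y y' : S, y' = y → ∀ v v' : Cn s, v' = v → η y v = η y' v' := by
    rintro y _ rfl v _ rfl; rfl
  rw [RealForm.inner_coeff]
  refine key _ _ ((chartAt (Cn s) x).left_inv hS) _ _ ?_
  rw [← h1]
  refine hc'.symm.trans (Eq.trans ?_ hc)
  rw [hev.mfderiv_eq]
  rfl

omit [IsManifold 𝓘(ℂ, Cn s) ω S] in
theorem discForm_apply {u w : Cn m} (hu : u ∈ (chartAt (Cn m) (ι x)).target)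
    (hD : (chartAt (Cn m) (ι x)).symm u ∈ N.diffeo.source)
    (hd : DifferentiableAt ℝ N.chartMap u) :
    N.discForm ((chartAt (Cn m) (ι x)).symm u)
        (mfderiv 𝓘(ℝ, Cn m) 𝓘(ℝ, Cn m) (chartAt (Cn m) (ι x)).symm u w) =
      inner ℝ ((2 : ℝ) • (N.chartMap u).2) (fderiv ℝ N.chartMap u w).2 := by
  have he := mdifferentiableAt_chartAt_symm (𝕜 := ℝ) (ι x) hu
  have hB := (N.contMDiffAt_toDisc hD).mdifferentiableAt (by simp)
  have hc := mfderiv_comp_apply u hB he w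
  have h2 : mfderiv 𝓘(ℝ, Cn m) 𝓘(ℝ, EuclideanSpace ℝ (Fin k))
      (N.toDisc ∘ (chartAt (Cn m) (ι x)).symm) u w = (fderiv ℝ N.chartMap u w).2 := by
    have : (fderiv ℝ (fun u => (N.chartMap u).2) u) w = (fderiv ℝ N.chartMap u w).2 := by
      rw [fderiv.snd hd]; rfl
    rw [← this, ← mfderiv_eq_fderiv]
    rfl
  have h3 : ∀ y v : EuclideanSpace ℝ (Fin k), mfderiv 𝓘(ℝ, EuclideanSpace ℝ (Fin k)) 𝓘(ℝ, ℝ)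
      (fun y : EuclideanSpace ℝ (Fin k) => ‖y‖ ^ 2) y v = inner ℝ ((2 : ℝ) • y) v := by
    intro y v
    rw [mfderiv_eq_fderiv, (hasStrictFDerivAt_norm_sq y).hasFDerivAt.fderiv, inner_smul_left]
    simp [two_smul, two_mul]
    rfl
  exact (h3 (N.toDisc _) _).trans
    (congrArg (fun v => inner ℝ ((2 : ℝ) • (N.chartMap u).2) v) (hc.symm.trans h2))

/-- The pull-back of a form along `chartMap` acts on coefficient vectors by the transposed
derivative; the two components come from `π^* η` and `p^* dρ`. -/
theorem eventually_coeff_eq (η : RealForm s S) :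
    ∀ᶠ u in 𝓝 (chartAt (Cn m) (ι x) (ι x)), (N.radialExtension η).coeff (ι x) u =
      pullbackCoeff (fderiv ℝ N.chartMap u)
        (η.coeff x (N.chartMap u).1, (2 : ℝ) • (N.chartMap u).2) := by
  have h := (N.contDiffAt_chartMap.of_le (m := 1) (by exact_mod_cast le_top)).eventually (by simp)
  filter_upwards [N.eventually_mem, h] with u ⟨h1, h2, h3⟩ h4
  refine ext_inner_right ℝ fun w => ?_
  have hd := h4.differentiableAt one_ne_zero
  rw [inner_pullbackCoeff, RealForm.inner_coeff, ← N.parallelExtension_apply h1 h2 h3 hd,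
    ← N.discForm_apply h1 h2 hd]
  rfl

/-- Continuity is assumed for the coefficients only, which suits both real forms and real parts of
complex ones. The first conclusion is kept for the comparison of complex and real indices on `M`. -/
theorem index_radialExtension {η : RealForm s S}
    (hη : ContinuousOn (η.coeff x) (chartAt (Cn s) x).target)
    (h : η.IsIsolatedSingularity x) :
    (∃ r > 0, ContinuousOn ((N.radialExtension η).coeff (ι x))
        (closedBall (chartAt (Cn m) (ι x) (ι x)) r) ∧
      ∀ u ∈ closedBall (chartAt (Cn m) (ι x) (ι x)) r \ {chartAt (Cn m) (ι x) (ι x)},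
        (N.radialExtension η).coeff (ι x) u ≠ 0) ∧
    (N.radialExtension η).IsIsolatedSingularity (ι x) ∧
    η.index x = (N.radialExtension η).index (ι x) := by
  obtain ⟨ρ, hρ, hsub, hne⟩ := h.exists_closedBall
  have hG : ContinuousOn (η.coeff x) (closedBall (chartAt (Cn s) x x) ρ) :=
    hη.mono hsub
  obtain ⟨L, hL⟩ := N.exists_fderiv_chartMap_eq
  obtain ⟨r, hr, hFc, hFne, hdeg⟩ := exists_hasProperDegree_pullback volume volume hρ hG hne
    (N.contDiffAt_chartMap.of_le (m := 1) (by exact_mod_cast le_top)) L hL N.chartMap_apply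
    (N.eventually_coeff_eq η)
  refine ⟨⟨r, hr, hFc, hFne⟩,
    RealForm.isIsolatedSingularity_of_coeff (N.radialExtension_apply_eq_zero h.1) hr hFne, ?_⟩
  have hFc' := hFc.mono (sdiff_subset (t := {chartAt (Cn m) (ι x) (ι x)}))
  have hG' := hG.mono (sdiff_subset (t := {chartAt (Cn s) x x}))
  rcases Nat.eq_zero_or_pos m with rfl | hm
  · have hs : s = 0 := by
      by_contra hs
      have : NeZero s := ⟨hs⟩
      obtain ⟨v, hv⟩ := exists_ne (0 : Cn s)
      exact hv (congrArg Prod.fst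
        (L.symm.injective (Subsingleton.elim (L.symm (v, 0)) (L.symm (0, 0)))))
    subst hs
    simp [RealForm.index]
  have : NeZero m := ⟨hm.ne'⟩
  rw [RealForm.index, RealForm.index, if_neg hm.ne']
  rcases Nat.eq_zero_or_pos s with rfl | hs
  -- The convention for a point agrees with the degree `1` of the only self-map of the zero space,
  -- so the transfer applies unchanged.
  · rw [if_pos rfl]
    exact (localDegree_eq hFc' hFne hr
      (hdeg 1 (hasProperDegree_homExt_of_subsingleton volume _))).symm
  · have : NeZero s := ⟨hs.ne'⟩
    rw [if_neg hs.ne']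
    obtain ⟨d, hd⟩ := exists_hasProperDegree_of_isolated hG' hne volume hρ
    rw [localDegree_eq hG' hne hρ hd, localDegree_eq hFc' hFne hr (hdeg d hd)]

end ProductNhd
end

noncomputable section

/-! ### Complex 1-forms -/

/-- Componentwise complex conjugation on `ℂ^n`. -/
def conjCn (n : ℕ) : Cn n ≃ₗᵢ[ℝ] Cn n :=
  LinearIsometryEquiv.piLpCongrRight 2 fun _ => Complex.conjLIE

theorem conjCn_apply {n : ℕ} (v : Cn n) (j : Fin n) : conjCn n v j = (starRingEnd ℂ) (v j) := rfl

theorem conjCn_conjCn {n : ℕ} (v : Cn n) : conjCn n (conjCn n v) = v := by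
  ext j
  simp [conjCn_apply]

/-- Conjugation is a product of `n` plane reflections. -/
theorem det_conjCn (n : ℕ) :
    LinearMap.det ((conjCn n).toLinearEquiv : Cn n →ₗ[ℝ] Cn n) = (-1) ^ n := by
  have h1 : (((WithLp.linearEquiv 2 ℝ (Fin n → ℂ) :
      Cn n ≃ₗ[ℝ] (Fin n → ℂ)) : Cn n →ₗ[ℝ] (Fin n → ℂ)) ∘ₗ
      ((conjCn n).toLinearEquiv : Cn n →ₗ[ℝ] Cn n) ∘ₗ
      ((WithLp.linearEquiv 2 ℝ (Fin n → ℂ)).symm : (Fin n → ℂ) →ₗ[ℝ] Cn n)) =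
      LinearMap.pi fun i : Fin n =>
        (Complex.conjAe.toLinearMap : ℂ →ₗ[ℝ] ℂ) ∘ₗ LinearMap.proj i := by
    ext v
    rfl
  rw [← LinearMap.det_conj _ (WithLp.linearEquiv 2 ℝ (Fin n → ℂ) : Cn n ≃ₗ[ℝ] (Fin n → ℂ)), h1,
    LinearMap.det_pi]
  have : LinearMap.det (Complex.conjAe.toLinearMap : ℂ →ₗ[ℝ] ℂ) = -1 := Complex.det_conjAe
  simp [this]

theorem HasProperDegree.conjCn_comp {n : ℕ} {F : Cn n → Cn n} {d : ℤ}
    (hd : HasProperDegree volume F d) :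
    HasProperDegree volume (fun v => conjCn n (F v)) ((-1) ^ n * d) := by
  have h := hd.linear_conj volume volume (ContinuousLinearEquiv.refl ℝ (Cn n))
    (conjCn n).toContinuousLinearEquiv
  have e : LinearMap.det ((((ContinuousLinearEquiv.refl ℝ (Cn n)).trans
      (conjCn n).toContinuousLinearEquiv).toLinearEquiv : Cn n ≃ₗ[ℝ] Cn n) : Cn n →ₗ[ℝ] Cn n) =
      (-1) ^ n := det_conjCn n
  rw [e] at h
  have e' : ((SignType.sign ((-1 : ℝ) ^ n) : SignType) : ℤ) = (-1) ^ n := by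
    rw [sign_pow]; simp
  rw [e'] at h
  exact h

section

variable {n : ℕ} {M : Type*} [TopologicalSpace M] [ChartedSpace (Cn n) M]

theorem ComplexForm.re_eq_zero_iff (θ : ComplexForm n M) (q : M) : θ.re q = 0 ↔ θ q = 0 := by
  constructor
  · intro h
    have h1 : ∀ v, (θ q v).re = 0 := fun v => congrArg (fun T => T v) h
    ext v
    refine Complex.ext (h1 v) ?_
    -- By complex linearity, `Re θ(iv) = -Im θ(v)`.
    have := h1 (Complex.I • v)
    rw [map_smul, smul_eq_mul, Complex.I_mul_re, neg_eq_zero] at this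
    exact this
  · intro h
    ext v
    exact congrArg (fun T => (T v).re) h

theorem ComplexForm.isIsolatedSingularity_re_iff (θ : ComplexForm n M) (q : M) :
    θ.re.IsIsolatedSingularity q ↔ θ.IsIsolatedSingularity q := by
  simp only [RealForm.IsIsolatedSingularity, ComplexForm.IsIsolatedSingularity, ne_eq,
    θ.re_eq_zero_iff]

theorem RealForm.re_complexify (η : RealForm n M) : η.complexify.re = η := by
  funext q
  ext v
  change (((η q v : ℝ) : ℂ) - Complex.I * ((η q (Complex.I • (show Cn n from v)) : ℝ) : ℂ)).re =
    η q v
  simp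

variable [IsManifold 𝓘(ℂ, Cn n) ω M]

instance complexManifold_one : IsManifold 𝓘(ℂ, Cn n) 1 M :=
  IsManifold.of_le (n := ω) le_top

theorem mfderiv_chartAt_symm_real (x : M) {u : Cn n} (hu : u ∈ (chartAt (Cn n) x).target)
    (w : Cn n) :
    (mfderiv 𝓘(ℝ, Cn n) 𝓘(ℝ, Cn n) (chartAt (Cn n) x).symm u w : Cn n) =
      mfderiv 𝓘(ℂ, Cn n) 𝓘(ℂ, Cn n) (chartAt (Cn n) x).symm u w := by
  have h := (mdifferentiableAt_chartAt_symm (𝕜 := ℂ) x hu).hasMFDerivAt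
  let T : Cn n →L[ℂ] Cn n := mfderiv 𝓘(ℂ, Cn n) 𝓘(ℂ, Cn n) (chartAt (Cn n) x).symm u
  have h' : HasMFDerivAt 𝓘(ℝ, Cn n) 𝓘(ℝ, Cn n) (chartAt (Cn n) x).symm u
      (T.restrictScalars ℝ) :=
    ⟨h.1, HasFDerivWithinAt.restrictScalars ℝ h.2⟩
  rw [h'.mfderiv]
  rfl

/-- The complex coefficients of a complex form are conjugate to the coefficients of its real
part. -/
theorem ComplexForm.coeff_eq_conjCn (θ : ComplexForm n M) (x : M) {u : Cn n}
    (hu : u ∈ (chartAt (Cn n) x).target) : θ.coeff x u = conjCn n (θ.re.coeff x u) := by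
  -- Both vectors represent `w ↦ Re ∑ a_j w_j`, which is the real inner product of `w` with the
  -- conjugate of `a`.
  have : θ.re.coeff x u = conjCn n (θ.coeff x u) := by
    refine ext_inner_right ℝ fun w => ?_
    rw [RealForm.inner_coeff]
    let T : Cn n →ₗ[ℂ] ℂ := ((θ ((chartAt (Cn n) x).symm u)).comp
      (mfderiv 𝓘(ℂ, Cn n) 𝓘(ℂ, Cn n) (chartAt (Cn n) x).symm u)).toLinearMap
    have h1 : T w = ∑ j, w j * θ.coeff x u j := by
      conv_lhs => rw [← (EuclideanSpace.basisFun (Fin n) ℂ).sum_repr w]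
      rw [map_sum]
      refine Finset.sum_congr rfl fun j _ => ?_
      rw [map_smul, EuclideanSpace.basisFun_apply, EuclideanSpace.basisFun_repr]
      rfl
    have h2 : θ.re ((chartAt (Cn n) x).symm u)
        (mfderiv 𝓘(ℝ, Cn n) 𝓘(ℝ, Cn n) (chartAt (Cn n) x).symm u w) = (T w).re :=
      congrArg (fun v => (θ ((chartAt (Cn n) x).symm u) v).re) (mfderiv_chartAt_symm_real x hu w)
    rw [h2, h1, PiLp.inner_apply, Complex.re_sum]
    refine Finset.sum_congr rfl fun j _ => ?_
    rw [conjCn_apply]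
    simp [Complex.inner]
  rw [this, conjCn_conjCn]

theorem ComplexForm.IsContinuous.continuousOn_coeff_re {θ : ComplexForm n M} (hθ : θ.IsContinuous)
    (x : M) : ContinuousOn (θ.re.coeff x) (chartAt (Cn n) x).target := by
  have h : ContinuousOn (θ.coeff x) (chartAt (Cn n) x).target := by
    refine (PiLp.continuous_toLp 2 _).comp_continuousOn (continuousOn_pi.2 fun j => ?_)
    exact (continuousOn_chart_pullback hθ x).clm_apply continuousOn_const
  refine ((conjCn n).continuous.comp_continuousOn h).congr fun u hu => ?_
  rw [Function.comp, θ.coeff_eq_conjCn x hu, conjCn_conjCn]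

/-- The two coefficient maps differ by conjugation in the target, which multiplies the degree by its
determinant `(-1)^n`. In dimension zero both sides are `1`. -/
theorem ComplexForm.index_eq (θ : ComplexForm n M) {x : M} (h : θ.re.IsIsolatedSingularity x)
    {r : ℝ} (hr : 0 < r) (hc : ContinuousOn (θ.re.coeff x) (closedBall (chartAt (Cn n) x x) r)) :
    θ.index x = (-1) ^ n * θ.re.index x := by
  rcases Nat.eq_zero_or_pos n with rfl | hn
  · simp [RealForm.index, ComplexForm.index]
  have : NeZero n := ⟨hn.ne'⟩
  rw [RealForm.index, ComplexForm.index, if_neg hn.ne', if_neg hn.ne']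
  set a := chartAt (Cn n) x x
  obtain ⟨ρ, hρ, hsub, hne⟩ := h.exists_closedBall
  have hR : 0 < min r ρ := lt_min hr hρ
  have hsubR : closedBall a (min r ρ) ⊆ closedBall a ρ := closedBall_subset_closedBall
    (min_le_right _ _)
  have hcR : ContinuousOn (θ.re.coeff x) (closedBall a (min r ρ) \ {a}) :=
    hc.mono (sdiff_subset.trans (closedBall_subset_closedBall (min_le_left _ _)))
  have hneR : ∀ u ∈ closedBall a (min r ρ) \ {a}, θ.re.coeff x u ≠ 0 := fun u hu =>
    hne u ⟨hsubR hu.1, hu.2⟩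
  have heq : ∀ u ∈ closedBall a (min r ρ), θ.coeff x u = conjCn n (θ.re.coeff x u) := fun u hu =>
    θ.coeff_eq_conjCn x (hsub (hsubR hu))
  obtain ⟨d, hd⟩ := exists_hasProperDegree_of_isolated hcR hneR volume hR
  rw [localDegree_eq hcR hneR hR hd]
  refine localDegree_eq (r := min r ρ) ?_ ?_ hR ?_
  · exact ((conjCn n).continuous.comp_continuousOn hcR).congr fun u hu => heq u hu.1
  · intro u hu
    rw [heq u hu.1]
    exact (conjCn n).map_ne_zero_iff.2 (hneR u hu)
  · have e : (homExt fun v => θ.coeff x (a + min r ρ • v)) =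
        fun v => conjCn n (homExt (fun v => θ.re.coeff x (a + min r ρ • v)) v) := by
      funext v
      rcases eq_or_ne v 0 with rfl | hv
      · simp [homExt]
      · rw [homExt, homExt, heq, map_smul]
        exact (add_smul_mem_closedBall_diff hR le_rfl (norm_inv_smul_mem_sphere hv)).1
    rw [e]
    exact hd.conjCn_comp

end

end

theorem mainTheorem3 {m s k : ℕ}
    {M : Type*} [TopologicalSpace M] [T2Space M] [ChartedSpace (Cn m) M]
    [IsManifold 𝓘(ℂ, Cn m) ω M]
    {S : Type*} [TopologicalSpace S] [ChartedSpace (Cn s) S] [IsManifold 𝓘(ℂ, Cn s) ω S]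
    (ι : S → M) (hι : Manifold.IsSmoothEmbedding 𝓘(ℂ, Cn s) 𝓘(ℂ, Cn m) ω ι)
    (x : S) (N : ProductNhd (m := m) (s := s) ι x k) :
    (∀ η : RealForm s S, η.IsContinuous → η.IsIsolatedSingularity x →
      (N.radialExtension η).IsIsolatedSingularity (ι x) ∧
      η.index x = (N.radialExtension η).index (ι x)) ∧
    (∀ θ : ComplexForm s S, θ.IsContinuous → θ.IsIsolatedSingularity x →
      (N.complexRadialExtension θ).IsIsolatedSingularity (ι x) ∧
      (-1) ^ s * θ.index x = (-1) ^ m * (N.complexRadialExtension θ).index (ι x)) := by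
  refine ⟨fun η hη h => (N.index_radialExtension (hη.continuousOn_coeff x) h).2, fun θ hθ h => ?_⟩
  have hre := (θ.isIsolatedSingularity_re_iff x).2 h
  have hθc := hθ.continuousOn_coeff_re x
  obtain ⟨⟨r, hr, hc, -⟩, h1, h2⟩ := N.index_radialExtension hθc hre
  have e : (N.complexRadialExtension θ).re = N.radialExtension θ.re := RealForm.re_complexify _
  obtain ⟨ρ, hρ, hsub, -⟩ := hre.exists_closedBall
  rw [← e] at h1 h2 hc
  refine ⟨((N.complexRadialExtension θ).isIsolatedSingularity_re_iff _).1 h1, ?_⟩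
  -- The signs `(-1)^s` and `(-1)^m` meet those of the comparison with the real parts and square to
  -- `1`, leaving the real statement.
  rw [θ.index_eq hre hρ (hθc.mono hsub), (N.complexRadialExtension θ).index_eq h1 hr hc, h2,
    ← mul_assoc, ← mul_assoc, ← mul_pow, ← mul_pow]
  simp
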